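/- All graphs are finite, simple and non-empty. A trigraph $G=(V,E,R)$ consists of a finite non-empty set $V$ and disjoint sets $E$ (black edges) and $R$ (red edges) of unordered pairs of distinct elements of $V$. For distinct $u,v\in V$, the trigraph $G/u,v$ is obtained by replacing $u$ and $v$ by a new vertex $w$, leaving all pairs of other vertices unchanged, where for each $x\in V\setminus\{u,v\}$: $wx$ is a black edge if both $ux$ and $vx$ are black edges; $wx$ is a non-edge if neither $ux$ nor $vx$ is an edge (black or red); and $wx$ is a red edge otherwise. A reduction sequence of a graph $G$ is a sequence of trigraphs that starts with $(V(G),E(G),\emptyset)$ and ends with a trigraph with one vertex, where each later trigraph is obtained from the previous one by such an identification of two distinct vertices. A graph parameter is an isomorphism-invariant function $f$ from graphs to $\{0,1,2,\dots\}$. For a graph parameter $f$, let $f^{\downarrow}$ (reduced $f$) be the graph parameter where $f^{\downarrow}(G)$ is the minimum $k\ge 0$ such that $G$ has a reduction sequence in which the red graph $(V,R)$ of every trigraph has $f$ at most $k$. Let $\Delta$, $\mathrm{tw}$, $\mathrm{pw}$ and $\mathrm{bw}$ denote maximum degree, treewidth, pathwidth and bandwidth, and let $(f+g)(G)=f(G)+g(G)$;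 so $\Delta^{\downarrow}$ is twin-width. Write $f_1\preceq f_2$ if there is a function $h$ such that $f_1(G)\le h(f_2(G))$ for every graph $G$, and write $f_1\precneqq f_2$ if $f_1\preceq f_2$ and $f_2\not\preceq f_1$. Call $f_1$ and $f_2$ separated if $f_1\precneqq f_2$ or $f_2\precneqq f_1$. Theorem 6.1. $$\Delta^{\downarrow}\;\precneqq\;(\Delta+\mathrm{tw})^{\downarrow}\;\precneqq\;(\Delta+\mathrm{pw})^{\downarrow}\;\precneqq\;\mathrm{bw}^{\downarrow}.$$ Consequently, these four parameters are pairwise separated. -/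

import Mathlib

namespace ReducedParam

/-! ### Graph parameters

Graphs are finite simple graphs on a non-empty vertex set (a reduction sequence ends with a
one-vertex trigraph, so only non-empty graphs have one). -/

/-- A graph parameter: an isomorphism-invariant function from graphs to the natural numbers. -/
structure GraphParameter where
  val : ∀ {V : Type} [Finite V] [Nonempty V], SimpleGraph V → ℕ
  val_iso : ∀ {V W : Type} [Finite V] [Nonempty V] [Finite W] [Nonempty W]
    {G : SimpleGraph V} {H : SimpleGraph W}, Nonempty (G ≃g H) → val G = val H

/-- The sum of two graph parameters, `(f + g)(G) = f(G) + g(G)`. -/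
instance : Add GraphParameter where
  add f g :=
    { val := fun G => f.val G + g.val G
      val_iso := fun h => by rw [f.val_iso h, g.val_iso h] }

/-- `f` is functionally bounded by `g`: `f(G) ≤ h(g(G))` for a function `h` and all graphs `G`. -/
def FunctionallyBounded (f g : GraphParameter) : Prop :=
  ∃ h : ℕ → ℕ, ∀ (V : Type) [Finite V] [Nonempty V] (G : SimpleGraph V),
    f.val G ≤ h (g.val G)

/-- `f` is functionally bounded by `g`, but not conversely. -/
def StrictlyBounded (f g : GraphParameter) : Prop :=
  FunctionallyBounded f g ∧ ¬ FunctionallyBounded g f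

/-- Two parameters are separated if one of them is strictly below the other. -/
def Separated (f g : GraphParameter) : Prop :=
  StrictlyBounded f g ∨ StrictlyBounded g f

/-! ### Maximum degree -/

open Classical in
/-- The maximum degree of a finite graph. -/
noncomputable def maxDeg {V : Type} [Finite V] (G : SimpleGraph V) : ℕ :=
  letI := Fintype.ofFinite V
  G.maxDegree

/-! ### Tree-decompositions, treewidth and pathwidth -/

/-- A tree-decomposition of `G` whose tree has node set `T`. -/
structure TreeDecomposition {V : Type} (G : SimpleGraph V) (T : Type) where
  tree : SimpleGraph T
  isTree : tree.IsTree
  bag : T → Set V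
  edge_mem : ∀ u v : V, G.Adj u v → ∃ x : T, u ∈ bag x ∧ v ∈ bag x
  /-- The nodes whose bags contain `v` induce a non-empty connected subgraph of the tree. -/
  connected : ∀ v : V, (tree.induce {x : T | v ∈ bag x}).Connected

/-- The size of the largest bag minus 1 (for a graph with a vertex and a finite tree, some bag is
non-empty and the supremum is attained). -/
noncomputable def TreeDecomposition.width {V : Type} {G : SimpleGraph V} {T : Type}
    (D : TreeDecomposition G T) : ℕ :=
  (⨆ x : T, (D.bag x).ncard) - 1

/-- A path-decomposition is a tree-decomposition whose tree is a path. -/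
def TreeDecomposition.IsPathDecomposition {V : Type} {G : SimpleGraph V} {T : Type}
    (D : TreeDecomposition G T) : Prop :=
  ∃ n : ℕ, Nonempty (D.tree ≃g SimpleGraph.pathGraph n)

/-- The minimum width of a tree-decomposition of `G`. -/
noncomputable def treewidth {V : Type} (G : SimpleGraph V) : ℕ :=
  sInf {k : ℕ | ∃ (T : Type) (_ : Finite T) (D : TreeDecomposition G T), D.width = k}

/-- The minimum width of a path-decomposition of `G`. -/
noncomputable def pathwidth {V : Type} (G : SimpleGraph V) : ℕ :=
  sInf {k : ℕ | ∃ (T : Type) (_ : Finite T) (D : TreeDecomposition G T),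
    D.IsPathDecomposition ∧ D.width = k}

/-! ### Bandwidth -/

/-- The minimum `k` such that some linear ordering of the vertices puts the ends of every edge at
distance at most `k`. -/
noncomputable def bandwidth {V : Type} (G : SimpleGraph V) : ℕ :=
  sInf {k : ℕ | ∃ σ : V ≃ Fin (Nat.card V), ∀ u v : V, G.Adj u v →
    |((σ u : ℕ) : ℤ) - ((σ v : ℕ) : ℤ)| ≤ (k : ℤ)}

/-! ### Isomorphism invariance -/

theorem maxDeg_iso {V W : Type} [Finite V] [Finite W] {G : SimpleGraph V} {H : SimpleGraph W}
    (h : Nonempty (G ≃g H)) : maxDeg G = maxDeg H := by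
  classical
  obtain ⟨e⟩ := h
  let _ := Fintype.ofFinite V
  let _ := Fintype.ofFinite W
  unfold maxDeg
  convert e.maxDegree_eq

/-- Transport of a tree-decomposition along a graph isomorphism. -/
def TreeDecomposition.map {V W T : Type} {G : SimpleGraph V} {H : SimpleGraph W}
    (D : TreeDecomposition G T) (e : G ≃g H) : TreeDecomposition H T where
  tree := D.tree
  isTree := D.isTree
  bag x := e.symm ⁻¹' D.bag x
  edge_mem u v h := D.edge_mem (e.symm u) (e.symm v) (e.symm.map_adj_iff.2 h)
  connected v := D.connected (e.symm v)

theorem TreeDecomposition.width_map {V W T : Type} {G : SimpleGraph V} {H : SimpleGraph W}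
    (D : TreeDecomposition G T) (e : G ≃g H) : (D.map e).width = D.width := by
  unfold TreeDecomposition.width
  congr 2
  funext x
  exact Set.ncard_preimage_of_injective_subset_range e.symm.injective
    (by rw [e.symm.surjective.range_eq]; exact Set.subset_univ _)

theorem treewidth_iso {V W : Type} {G : SimpleGraph V} {H : SimpleGraph W}
    (h : Nonempty (G ≃g H)) : treewidth G = treewidth H := by
  obtain ⟨e⟩ := h
  unfold treewidth
  congr 1
  ext k
  constructor
  · rintro ⟨T, hT, D, rfl⟩
    exact ⟨T, hT, D.map e, D.width_map e⟩
  · rintro ⟨T, hT, D, rfl⟩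
    exact ⟨T, hT, D.map e.symm, D.width_map e.symm⟩

theorem pathwidth_iso {V W : Type} {G : SimpleGraph V} {H : SimpleGraph W}
    (h : Nonempty (G ≃g H)) : pathwidth G = pathwidth H := by
  obtain ⟨e⟩ := h
  unfold pathwidth
  congr 1
  ext k
  constructor
  · rintro ⟨T, hT, D, hD, rfl⟩
    exact ⟨T, hT, D.map e, hD, D.width_map e⟩
  · rintro ⟨T, hT, D, hD, rfl⟩
    exact ⟨T, hT, D.map e.symm, hD, D.width_map e.symm⟩

theorem bandwidth_iso {V W : Type} {G : SimpleGraph V} {H : SimpleGraph W}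
    (h : Nonempty (G ≃g H)) : bandwidth G = bandwidth H := by
  obtain ⟨e⟩ := h
  have hc : Nat.card V = Nat.card W := Nat.card_congr e.toEquiv
  unfold bandwidth
  congr 1
  ext k
  constructor
  · rintro ⟨σ, hσ⟩
    refine ⟨(e.symm.toEquiv.trans σ).trans (finCongr hc), fun u v huv => ?_⟩
    simpa using hσ (e.symm u) (e.symm v) (e.symm.map_adj_iff.2 huv)
  · rintro ⟨σ, hσ⟩
    refine ⟨(e.toEquiv.trans σ).trans (finCongr hc.symm), fun u v huv => ?_⟩
    simpa using hσ (e u) (e v) (e.map_adj_iff.2 huv)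

/-- Maximum degree as a graph parameter. -/
noncomputable def maxDegParam : GraphParameter where
  val G := maxDeg G
  val_iso h := maxDeg_iso h

/-- Treewidth as a graph parameter. -/
noncomputable def treewidthParam : GraphParameter where
  val G := treewidth G
  val_iso h := treewidth_iso h

/-- Pathwidth as a graph parameter. -/
noncomputable def pathwidthParam : GraphParameter where
  val G := pathwidth G
  val_iso h := pathwidth_iso h

/-- Bandwidth as a graph parameter. -/
noncomputable def bandwidthParam : GraphParameter where
  val G := bandwidth G
  val_iso h := bandwidth_iso h

/-! ### Trigraphs and reduction sequences -/

/-- A trigraph: disjoint sets of black and red edges on the same vertex set. -/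
structure Trigraph (V : Type) where
  black : SimpleGraph V
  red : SimpleGraph V
  disjoint : ∀ x y : V, black.Adj x y → ¬ red.Adj x y

/-- The trigraph of a graph: all edges are black. -/
def Trigraph.ofGraph {V : Type} (G : SimpleGraph V) : Trigraph V where
  black := G
  red := ⊥
  disjoint _ _ _ h := h

/-- The graph of all black and red edges. -/
def Trigraph.total {V : Type} (G : Trigraph V) : SimpleGraph V := G.black ⊔ G.red

/-- The trigraph `G/u,v`: the vertices `u` and `v` are replaced by the new vertex `none`, and the
other vertices `x` are kept as `some x`. -/
def Trigraph.contract {V : Type} (G : Trigraph V) (u v : V) :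
    Trigraph (Option {x : V // x ≠ u ∧ x ≠ v}) where
  black :=
    { Adj := fun a b => match a, b with
        | some x, some y => G.black.Adj x y
        | none, some x => G.black.Adj u x ∧ G.black.Adj v x
        | some x, none => G.black.Adj u x ∧ G.black.Adj v x
        | none, none => False
      symm := ⟨by
        rintro (_ | x) (_ | y) h
        · exact h
        · exact h
        · exact h
        · exact G.black.adj_symm h⟩
      loopless := ⟨by
        rintro (_ | x) h
        · exact h
        · exact G.black.irrefl h⟩ }
  red :=
    { Adj := fun a b => match a, b with
        | some x, some y => G.red.Adj x y
        | none, some x => ¬ (G.black.Adj u x ∧ G.black.Adj v x) ∧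
            ¬ (¬ G.total.Adj u x ∧ ¬ G.total.Adj v x)
        | some x, none => ¬ (G.black.Adj u x ∧ G.black.Adj v x) ∧
            ¬ (¬ G.total.Adj u x ∧ ¬ G.total.Adj v x)
        | none, none => False
      symm := ⟨by
        rintro (_ | x) (_ | y) h
        · exact h
        · exact h
        · exact h
        · exact G.red.adj_symm h⟩
      loopless := ⟨by
        rintro (_ | x) h
        · exact h
        · exact G.red.irrefl h⟩ }
  disjoint := by
    rintro (_ | x) (_ | y) h h'
    · exact h
    · exact h'.1 h
    · exact h'.1 h
    · exact G.disjoint _ _ h h'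

/-- A reduction sequence of the trigraph `G`: either `G` has exactly one vertex, or two distinct
vertices `u`, `v` are identified and a reduction sequence of `G/u,v` follows. -/
inductive ReductionSequence :
    ∀ {V : Type} [Finite V] [Nonempty V], Trigraph V → Type 1
  | single {V : Type} [Finite V] [Nonempty V] (G : Trigraph V) (h : Nat.card V = 1) :
      ReductionSequence G
  | step {V : Type} [Finite V] [Nonempty V] (G : Trigraph V) (u v : V) (h : u ≠ v)
      (S : ReductionSequence (G.contract u v)) : ReductionSequence G

/-- Every red graph in the reduction sequence (the first and the last one included) has `f` at
most `k`. -/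
def ReductionSequence.RedAtMost (f : GraphParameter) (k : ℕ) :
    ∀ {V : Type} [Finite V] [Nonempty V] {G : Trigraph V}, ReductionSequence G → Prop
  | _, _, _, _, @single _ _ _ G _ => f.val G.red ≤ k
  | _, _, _, _, @step _ _ _ G _ _ _ S => f.val G.red ≤ k ∧ S.RedAtMost f k

/-- The minimum `k` such that some reduction sequence of `G` has all its red graphs with `f` at
most `k`. -/
noncomputable def reducedVal (f : GraphParameter) {V : Type} [Finite V] [Nonempty V]
    (G : SimpleGraph V) : ℕ :=
  sInf {k : ℕ | ∃ S : ReductionSequence (Trigraph.ofGraph G), S.RedAtMost f k}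

theorem ReductionSequence.exists_transport (f : GraphParameter) (k : ℕ)
    {V : Type} [Finite V] [Nonempty V] {G : Trigraph V} (S : ReductionSequence G) :
    S.RedAtMost f k → ∀ {W : Type} [Finite W] [Nonempty W] (H : Trigraph W) (e : V ≃ W),
      (∀ x y, H.black.Adj (e x) (e y) ↔ G.black.Adj x y) →
      (∀ x y, H.red.Adj (e x) (e y) ↔ G.red.Adj x y) →
      ∃ S' : ReductionSequence H, S'.RedAtMost f k := by
  induction S with
  | single G h =>
    intro hS W _ _ H e _ hr
    refine ⟨.single H (by rw [← Nat.card_congr e, h]), ?_⟩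
    have : f.val G.red = f.val H.red := f.val_iso ⟨⟨e, hr _ _⟩⟩
    have hS : f.val G.red ≤ k := hS
    exact show f.val H.red ≤ k from this ▸ hS
  | @step V _ _ G u v h S ih =>
    intro hS W _ _ H e hb hr
    have hf : f.val G.red = f.val H.red := f.val_iso ⟨⟨e, hr _ _⟩⟩
    have ht : ∀ x y, H.total.Adj (e x) (e y) ↔ G.total.Adj x y := fun x y => by
      simp [Trigraph.total, hb, hr]
    let e' : {x : V // x ≠ u ∧ x ≠ v} ≃ {y : W // y ≠ e u ∧ y ≠ e v} :=
      e.subtypeEquiv (fun x => by simp)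
    have he' : ∀ x, ((e' x : {y : W // y ≠ e u ∧ y ≠ e v}) : W) = e x := fun _ => rfl
    obtain ⟨S', hS'⟩ := ih hS.2 (H.contract (e u) (e v)) (Equiv.optionCongr e')
      (by rintro (_ | x) (_ | y) <;> simp [Trigraph.contract, he', hb])
      (by rintro (_ | x) (_ | y) <;> simp [Trigraph.contract, he', hb, hr, ht])
    exact ⟨.step H (e u) (e v) (e.injective.ne h) S', hf ▸ hS.1, hS'⟩

theorem reducedVal_iso (f : GraphParameter) {V W : Type} [Finite V] [Nonempty V] [Finite W]
    [Nonempty W] {G : SimpleGraph V} {H : SimpleGraph W} (h : Nonempty (G ≃g H)) :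
    reducedVal f G = reducedVal f H := by
  obtain ⟨e⟩ := h
  unfold reducedVal
  congr 1
  ext k
  constructor
  · rintro ⟨S, hS⟩
    exact S.exists_transport f k hS _ e.toEquiv (fun _ _ => e.map_adj_iff)
      (fun _ _ => by simp [Trigraph.ofGraph])
  · rintro ⟨S, hS⟩
    exact S.exists_transport f k hS _ e.symm.toEquiv (fun _ _ => e.symm.map_adj_iff)
      (fun _ _ => by simp [Trigraph.ofGraph])

/-- The graph parameter reduced `f`. -/
noncomputable def reduced (f : GraphParameter) : GraphParameter where
  val G := reducedVal f G
  val_iso h := reducedVal_iso f h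

end ReducedParam

namespace ReducedParam

open SimpleGraph

/-! The bounds from left to right are pointwise: `Δ ≤ Δ + tw ≤ Δ + pw ≤ 3 bw` holds for every red
graph of an optimal reduction sequence. The content is that no bound can be reversed
(`not_functionallyBounded_reduced`). Each separation starts from connected graphs `H` that separate
the unreduced parameters: grids (bounded degree, large treewidth), ternary trees (bounded degree and
treewidth, large pathwidth), combs (bounded degree and pathwidth, large bandwidth). The test graph
is the product of `H` with a clique `K_n`, where `n` is huge compared with `H`.

Lower bound (`val_le_of_redAtMost`). Call the set of vertices identified into one vertex of a
trigraph a part. Let `f` be monotone and bound the maximum degree. Stop just before the first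
contraction that merges parts from the cliques of two different vertices `h`, `h'` of `H`. The
merged vertex is joined in red to almost all parts of the clique of `h`, so that clique has few
parts. The number of parts grows only by a bounded factor along an edge of `H`, so all cliques have
few parts, fewer than `n` in total. Then in some column every vertex shares its part with another
vertex of its clique. The parts of that column span a red copy of `H`, and `f(H)` is a lower bound.

Upper bound (`reducedVal_boxProd_le`). Merge the columns one at a time into column `0`, and then
contract the remaining copy of `H`. Edges inside cliques never turn red, and untouched columns are
black, so red edges lie only in column `0` and the column being merged. The red graph is thus
contained in a doubled copy of a host graph `Y` for the contractions of `H`. Doubling increases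
degree, treewidth and pathwidth only by constant factors, up to additive constants. For trees and
combs `Y` is `H` itself; for grids it is the grid with diagonals, which still has bounded degree. -/

/-! ### Basic properties of the parameters -/

/-- A graph parameter is monotone if it does not increase when passing to subgraphs. -/
def GraphParameter.IsMonotone (f : GraphParameter) : Prop :=
  ∀ {V W : Type} [Finite V] [Nonempty V] [Finite W] [Nonempty W] (G : SimpleGraph V)
    (H : SimpleGraph W) (φ : V → W), Function.Injective φ →
    (∀ a b, G.Adj a b → H.Adj (φ a) (φ b)) → f.val G ≤ f.val H

theorem GraphParameter.IsMonotone.add {f g : GraphParameter} (hf : f.IsMonotone)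
    (hg : g.IsMonotone) : (f + g).IsMonotone := fun G H φ hφ h =>
  Nat.add_le_add (hf G H φ hφ h) (hg G H φ hφ h)

theorem maxDeg_le_iff {V : Type} [Finite V] {G : SimpleGraph V} {k : ℕ} :
    maxDeg G ≤ k ↔ ∀ v, (G.neighborSet v).ncard ≤ k := by
  classical
  let _ := Fintype.ofFinite V
  have hd : ∀ v, (G.neighborSet v).ncard = G.degree v := fun v => by
    rw [Set.ncard_eq_toFinset_card', ← card_neighborFinset_eq_degree]; rfl
  have hm : maxDeg G = G.maxDegree := by
    unfold maxDeg
    convert rfl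
  simp only [hd, hm]
  exact ⟨fun h v => (G.degree_le_maxDegree v).trans h,
    fun h => G.maxDegree_le_of_forall_degree_le k h⟩

theorem maxDegParam_isMonotone : maxDegParam.IsMonotone := by
  intro V W _ _ _ _ G H φ hφ h
  refine maxDeg_le_iff.2 fun v => ?_
  refine le_trans ?_ (maxDeg_le_iff.1 le_rfl (φ v))
  exact Set.ncard_le_ncard_of_injOn φ (fun w hw => h _ _ hw) hφ.injOn (Set.toFinite _)

namespace TreeDecomposition

variable {V W T : Type} {G : SimpleGraph V} {H : SimpleGraph W}

theorem width_le (D : TreeDecomposition G T) {k : ℕ} (h : ∀ x, (D.bag x).ncard ≤ k + 1) :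
    D.width ≤ k := by
  have := D.isTree.connected.nonempty
  have : (⨆ x, (D.bag x).ncard) ≤ k + 1 := ciSup_le h
  unfold width
  omega

theorem ncard_bag_le [Finite T] (D : TreeDecomposition G T) (x : T) :
    (D.bag x).ncard ≤ D.width + 1 := by
  have : (D.bag x).ncard ≤ ⨆ x, (D.bag x).ncard :=
    le_ciSup (f := fun x => (D.bag x).ncard) (Set.finite_range _).bddAbove x
  unfold width
  omega

/-- Restriction of a tree-decomposition to a subgraph. -/
def comap (D : TreeDecomposition H T) (φ : V → W)
    (h : ∀ a b, G.Adj a b → H.Adj (φ a) (φ b)) : TreeDecomposition G T where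
  tree := D.tree
  isTree := D.isTree
  bag x := φ ⁻¹' D.bag x
  edge_mem _ _ huv := D.edge_mem _ _ (h _ _ huv)
  connected v := D.connected (φ v)

theorem width_comap_le [Finite T] [Finite W] (D : TreeDecomposition H T) (φ : V → W)
    (hφ : Function.Injective φ) (h : ∀ a b, G.Adj a b → H.Adj (φ a) (φ b)) :
    (D.comap φ h).width ≤ D.width :=
  width_le _ fun _ => le_trans
    (Set.ncard_le_ncard_of_injOn φ (fun _ hv => hv) hφ.injOn (Set.toFinite _)) (D.ncard_bag_le _)

end TreeDecomposition

theorem treewidth_le_width {V T : Type} [Finite T] {G : SimpleGraph V}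
    (D : TreeDecomposition G T) : treewidth G ≤ D.width :=
  Nat.sInf_le ⟨T, inferInstance, D, rfl⟩

theorem pathwidth_le_width {V T : Type} [Finite T] {G : SimpleGraph V}
    (D : TreeDecomposition G T) (hD : D.IsPathDecomposition) : pathwidth G ≤ D.width :=
  Nat.sInf_le ⟨T, inferInstance, D, hD, rfl⟩

theorem exists_isPathDecomposition {V : Type} (G : SimpleGraph V) :
    ∃ D : TreeDecomposition G (Fin 1), D.IsPathDecomposition :=
  ⟨{ tree := pathGraph 1
     isTree := .of_subsingleton
     bag := fun _ => Set.univ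
     edge_mem := fun _ _ _ => ⟨0, trivial, trivial⟩
     connected := fun v =>
      have : Nonempty {_x : Fin 1 | v ∈ (Set.univ : Set V)} := ⟨0, trivial⟩
      .of_subsingleton }, 1, ⟨Iso.refl⟩⟩

theorem exists_width_eq_pathwidth {V : Type} (G : SimpleGraph V) :
    ∃ (T : Type) (_ : Finite T) (D : TreeDecomposition G T),
      D.IsPathDecomposition ∧ D.width = pathwidth G := by
  obtain ⟨D, hD⟩ := exists_isPathDecomposition G
  exact Nat.sInf_mem (s := {k : ℕ | ∃ (T : Type) (_ : Finite T) (D : TreeDecomposition G T),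
    D.IsPathDecomposition ∧ D.width = k}) ⟨_, _, inferInstance, D, hD, rfl⟩

theorem exists_width_eq_treewidth {V : Type} (G : SimpleGraph V) :
    ∃ (T : Type) (_ : Finite T) (D : TreeDecomposition G T), D.width = treewidth G := by
  obtain ⟨D, hD⟩ := exists_isPathDecomposition G
  exact Nat.sInf_mem (s := {k : ℕ | ∃ (T : Type) (_ : Finite T) (D : TreeDecomposition G T),
    D.width = k}) ⟨_, _, inferInstance, D, rfl⟩

theorem treewidth_le_pathwidth {V : Type} (G : SimpleGraph V) : treewidth G ≤ pathwidth G := by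
  obtain ⟨T, hT, D, -, h⟩ := exists_width_eq_pathwidth G
  exact h ▸ treewidth_le_width D

theorem treewidthParam_isMonotone : treewidthParam.IsMonotone := by
  intro V W _ _ _ _ G H φ hφ h
  obtain ⟨T, hT, D, hD⟩ := exists_width_eq_treewidth H
  exact (treewidth_le_width (D.comap φ h)).trans ((D.width_comap_le φ hφ h).trans hD.le)

theorem pathwidthParam_isMonotone : pathwidthParam.IsMonotone := by
  intro V W _ _ _ _ G H φ hφ h
  obtain ⟨T, hT, D, hp, hD⟩ := exists_width_eq_pathwidth H
  exact (pathwidth_le_width (D.comap φ h) hp).trans ((D.width_comap_le φ hφ h).trans hD.le)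

/-! ### Trees given by a parent function -/

/-- The graph in which every element is joined to its parent. -/
def parentGraph {T : Type} (p : T → T) : SimpleGraph T := fromRel fun x y => y = p x

theorem parentGraph_adj {T : Type} {p : T → T} {x y : T} :
    (parentGraph p).Adj x y ↔ x ≠ y ∧ (y = p x ∨ x = p y) :=
  fromRel_adj _ _ _

theorem parentGraph_adj_parent {T : Type} {p : T → T} {x : T} (h : p x ≠ x) :
    (parentGraph p).Adj x (p x) := by
  simp [parentGraph, h.symm]

/-- The graph is connected because `d` decreases along parents until the root. Every edge is `s(x, p
x)` for some `x ≠ root`, so there are at most `|T| - 1` edges. -/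
theorem parentGraph_isTree {T : Type} [Finite T] (p : T → T) (root : T) (d : T → ℕ)
    (h : ∀ x, x ≠ root → d (p x) < d x) (hroot : p root = root) : (parentGraph p).IsTree := by
  classical
  have hr : ∀ n x, d x ≤ n → (parentGraph p).Reachable x root := by
    intro n
    induction n with
    | zero =>
      intro x hx
      by_cases hx' : x = root
      · rw [hx']
      · have := h x hx'
        omega
    | succ n ih =>
      intro x hx
      by_cases hx' : x = root
      · rw [hx']
      · have := h x hx'
        refine Reachable.trans (Adj.reachable (parentGraph_adj_parent ?_)) (ih (p x) (by omega))
        intro h'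
        rw [h'] at this
        exact lt_irrefl _ this
  have hc : (parentGraph p).Connected :=
    { preconnected := fun x y => (hr _ x le_rfl).trans (hr _ y le_rfl).symm
      nonempty := ⟨root⟩ }
  refine isTree_iff_connected_and_card.2 ⟨hc, ?_⟩
  refine le_antisymm ?_ (by simpa using hc.card_vert_le_card_edgeSet_add_one)
  have hsub : (parentGraph p).edgeSet ⊆ (fun x => s(x, p x)) '' {x | x ≠ root} := by
    intro e
    induction e with
    | _ a b =>
      intro he
      rw [mem_edgeSet, parentGraph_adj] at he
      obtain ⟨hab, rfl | rfl⟩ := he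
      · refine ⟨a, ?_, rfl⟩
        rintro rfl
        exact hab hroot.symm
      · refine ⟨b, ?_, Sym2.eq_swap⟩
        rintro rfl
        exact hab hroot
  have h1 := Set.ncard_le_ncard hsub (Set.toFinite _)
  have h2 := Set.ncard_image_le (f := fun x => s(x, p x)) (Set.toFinite {x : T | x ≠ root})
  have h3 : ({x : T | x ≠ root}).ncard + 1 = Nat.card T := by
    have := Set.ncard_add_ncard_compl {x : T | x ≠ root}
    have hs : {x : T | x ≠ root}ᶜ = {root} := by ext; simp
    rwa [hs, Set.ncard_singleton] at this
  rw [Nat.card_coe_set_eq]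
  omega

theorem pathGraph_isTree (n : ℕ) : (pathGraph (n + 1)).IsTree := by
  have : pathGraph (n + 1) = parentGraph (fun x : Fin (n + 1) => ⟨x.val - 1, by omega⟩) := by
    ext a b
    rw [pathGraph_adj, parentGraph_adj]
    simp only [Fin.ext_iff, ne_eq]
    omega
  rw [this]
  refine parentGraph_isTree _ 0 (fun x => x.val) (fun x hx => ?_) (by ext; simp)
  have : x.val ≠ 0 := fun h => hx (Fin.ext h)
  simp only
  omega

/-! ### Interval representations and bandwidth -/

/-- The bag at `p` consists of the vertices whose interval contains `p`. Used in both directions,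
`hadj` says that the intervals of adjacent vertices intersect; the larger left end is a common
point. -/
theorem pathwidth_le_of_intervals {V : Type} [Finite V] (G : SimpleGraph V) (l r : V → ℕ) (k : ℕ)
    (hlr : ∀ v, l v ≤ r v) (hadj : ∀ u v, G.Adj u v → l u ≤ r v)
    (hk : ∀ p, {v | l v ≤ p ∧ p ≤ r v}.ncard ≤ k + 1) : pathwidth G ≤ k := by
  obtain ⟨N, hN⟩ : ∃ N, ∀ v, r v ≤ N := by
    obtain ⟨N, hN⟩ := (Set.finite_range r).bddAbove
    exact ⟨N, fun v => hN ⟨v, rfl⟩⟩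
  have hb : ∀ v, r v < N + 1 := fun v => Nat.lt_succ_of_le (hN v)
  let D : TreeDecomposition G (Fin (N + 1)) :=
    { tree := pathGraph (N + 1)
      isTree := pathGraph_isTree N
      bag := fun x => {v | l v ≤ x ∧ x ≤ r v}
      edge_mem := fun u v huv => by
        have h1 := hadj u v huv
        have h2 := hadj v u huv.symm
        have h3 := hlr u
        have h4 := hlr v
        have h5 := hb u
        refine ⟨⟨max (l u) (l v), by omega⟩, ?_, ?_⟩ <;> simp only [Set.mem_ofPred_eq] <;> omega
      connected := fun v => by
        have hl : l v < N + 1 := (hlr v).trans_lt (hb v)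
        let a : {x : Fin (N + 1) | v ∈ {v | l v ≤ (x : ℕ) ∧ (x : ℕ) ≤ r v}} :=
          ⟨⟨l v, hl⟩, le_rfl, hlr v⟩
        refine connected_iff_exists_forall_reachable _ |>.2 ⟨a, ?_⟩
        have : ∀ n (hn : n < N + 1) (h : l v ≤ n ∧ n ≤ r v),
            ((pathGraph (N + 1)).induce
              {x : Fin (N + 1) | v ∈ {v | l v ≤ (x : ℕ) ∧ (x : ℕ) ≤ r v}}).Reachable a
                ⟨⟨n, hn⟩, h⟩ := by
          intro n
          induction n with
          | zero =>
            intro hn h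
            have : a = ⟨⟨0, hn⟩, h⟩ := by
              apply Subtype.ext
              apply Fin.ext
              change l v = 0
              omega
            rw [this]
          | succ n ih =>
            intro hn h
            by_cases h' : l v = n + 1
            · have : a = ⟨⟨n + 1, hn⟩, h⟩ := by
                apply Subtype.ext
                apply Fin.ext
                exact h'
              rw [this]
            · refine (ih (by omega) ⟨by omega, by omega⟩).trans (Adj.reachable ?_)
              simp [pathGraph_adj]
        rintro ⟨⟨n, hn⟩, h⟩
        exact this n hn h }
  exact (pathwidth_le_width D ⟨_, ⟨Iso.refl⟩⟩).trans (D.width_le fun x => hk x)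

/-- Order the vertices by `g`. Closing the gaps in the image of `g` only brings vertices closer
together. -/
theorem bandwidth_le_of_injective {V : Type} [Finite V] (G : SimpleGraph V) (g : V → ℤ)
    (hg : Function.Injective g) (k : ℕ) (h : ∀ u v, G.Adj u v → |g u - g v| ≤ k) :
    bandwidth G ≤ k := by
  classical
  let _ := Fintype.ofFinite V
  let _ : LinearOrder V := LinearOrder.lift' g hg
  let e : V ≃o Fin (Nat.card V) := (Fintype.orderIsoFinOfCardEq V Nat.card_eq_fintype_card.symm).symm
  have key : ∀ n u v, ((e v : ℕ) : ℤ) - (e u : ℕ) = (n : ℕ) → (n : ℤ) ≤ g v - g u := by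
    intro n
    induction n with
    | zero =>
      intro u v huv
      have : u = v := e.injective (Fin.ext (by push_cast at huv; omega))
      simp [this]
    | succ n ih =>
      intro u v huv
      have hv := (e v).isLt
      let w := e.symm ⟨(e v : ℕ) - 1, by omega⟩
      have hw : (e w : ℕ) = (e v : ℕ) - 1 := by simp [w]
      have h1 := ih u w (by push_cast at huv; omega)
      have h2 : w < v := by
        rw [← e.lt_iff_lt, Fin.lt_def]
        push_cast at huv
        omega
      have h3 : g w < g v := h2
      push_cast
      omega
  refine Nat.sInf_le ⟨e.toEquiv, fun u v huv => ?_⟩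
  have h1 := h u v huv
  change |((e u : ℕ) : ℤ) - ((e v : ℕ) : ℤ)| ≤ (k : ℤ)
  rw [abs_le] at h1 ⊢
  rcases le_total (e u) (e v) with h2 | h2
  · have h3 : (e u : ℕ) ≤ e v := h2
    have := key (e v - e u) u v (by omega)
    omega
  · have h3 : (e v : ℕ) ≤ e u := h2
    have := key (e u - e v) v u (by omega)
    omega

theorem exists_bandwidth_ordering {V : Type} [Finite V] (G : SimpleGraph V) :
    ∃ σ : V ≃ Fin (Nat.card V), ∀ u v : V, G.Adj u v →
      |((σ u : ℕ) : ℤ) - ((σ v : ℕ) : ℤ)| ≤ (bandwidth G : ℤ) := by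
  refine Nat.sInf_mem (s := {k : ℕ | ∃ σ : V ≃ Fin (Nat.card V), ∀ u v : V, G.Adj u v →
    |((σ u : ℕ) : ℤ) - ((σ v : ℕ) : ℤ)| ≤ (k : ℤ)}) ⟨Nat.card V, Finite.equivFin V, fun u v _ => ?_⟩
  have hu := (Finite.equivFin V u).isLt
  have hv := (Finite.equivFin V v).isLt
  rw [abs_le]
  omega

theorem bandwidthParam_isMonotone : bandwidthParam.IsMonotone := by
  intro V W _ _ _ _ G H φ hφ h
  obtain ⟨σ, hσ⟩ := exists_bandwidth_ordering H
  refine bandwidth_le_of_injective G (fun v => ((σ (φ v) : ℕ) : ℤ)) (fun a b hab => ?_) _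
    fun u v huv => hσ _ _ (h _ _ huv)
  exact hφ (σ.injective (Fin.ext (by simpa using hab)))

/-- Give the vertex at position `σ v` the interval from `σ v` to `σ v + bandwidth G`; a point lies
in at most `bandwidth G + 1` of these. -/
theorem pathwidth_le_bandwidth {V : Type} [Finite V] (G : SimpleGraph V) :
    pathwidth G ≤ bandwidth G := by
  obtain ⟨σ, hσ⟩ := exists_bandwidth_ordering G
  refine pathwidth_le_of_intervals G (fun v => σ v) (fun v => σ v + bandwidth G) _
    (fun v => Nat.le_add_right _ _) (fun u v huv => ?_) fun p => ?_
  · have := abs_le.1 (hσ u v huv)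
    omega
  · have := Set.ncard_le_ncard_of_injOn (s := {v | (σ v : ℕ) ≤ p ∧ p ≤ σ v + bandwidth G})
      (t := (Finset.Icc (p - bandwidth G) p : Set ℕ)) (fun v => (σ v : ℕ))
      (fun v hv => by
        simp only [Set.mem_ofPred_eq] at hv
        simp only [Finset.coe_Icc, Set.mem_Icc]
        omega)
      (fun a _ b _ hab => σ.injective (Fin.ext hab)) (Set.toFinite _)
    rw [Set.ncard_coe_finset, Nat.card_Icc] at this
    omega

theorem maxDeg_le_two_mul_bandwidth {V : Type} [Finite V] (G : SimpleGraph V) :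
    maxDeg G ≤ 2 * bandwidth G := by
  classical
  obtain ⟨σ, hσ⟩ := exists_bandwidth_ordering G
  refine maxDeg_le_iff.2 fun v => ?_
  have := Set.ncard_le_ncard_of_injOn (s := G.neighborSet v)
      (t := ((Finset.Icc ((σ v : ℕ) - bandwidth G : ℤ) ((σ v : ℕ) + bandwidth G)).erase
        ((σ v : ℕ) : ℤ) : Set ℤ))
      (fun v => ((σ v : ℕ) : ℤ))
      (fun w hw => by
        have h1 := abs_le.1 (hσ v w hw)
        have h2 : (σ w : ℕ) ≠ σ v := fun h => hw.ne' (σ.injective (Fin.ext h))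
        simp only [Finset.coe_erase, Finset.coe_Icc, Set.mem_sdiff, Set.mem_Icc,
          Set.mem_singleton_iff]
        omega)
      (fun a _ b _ hab => σ.injective (Fin.ext (by simpa using hab))) (Finset.finite_toSet _)
  rw [Set.ncard_coe_finset, Finset.card_erase_of_mem (by simp), Int.card_Icc] at this
  omega

/-! ### Reduction sequences -/

theorem ReductionSequence.RedAtMost.mono {f g : GraphParameter} {h : ℕ → ℕ} (hh : Monotone h)
    (hfg : ∀ {V : Type} [Finite V] [Nonempty V] (G : SimpleGraph V), f.val G ≤ h (g.val G))
    {k : ℕ} {V : Type} [Finite V] [Nonempty V] {G : Trigraph V} (S : ReductionSequence G) :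
    S.RedAtMost g k → S.RedAtMost f (h k) := by
  induction S with
  | single G _ => exact fun hS => (hfg G.red).trans (hh hS)
  | step G u v _ S ih => exact fun hS => ⟨(hfg G.red).trans (hh hS.1), ih hS.2⟩

theorem ReductionSequence.RedAtMost.weaken {f : GraphParameter} {k l : ℕ} (hkl : k ≤ l)
    {V : Type} [Finite V] [Nonempty V] {G : Trigraph V} {S : ReductionSequence G} :
    S.RedAtMost f k → S.RedAtMost f l := by
  induction S with
  | single G _ => exact fun hS => le_trans hS hkl
  | step G u v _ S ih => exact fun hS => ⟨hS.1.trans hkl, ih hS.2⟩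

/-- This makes the set in `reducedVal` non-empty, so that its infimum is attained and is not the
default value `0`. -/
theorem exists_reductionSequence (f : GraphParameter) :
    ∀ (n : ℕ) {V : Type} [Finite V] [Nonempty V] (G : Trigraph V), Nat.card V ≤ n →
      ∃ (S : ReductionSequence G) (k : ℕ), S.RedAtMost f k := by
  intro n
  induction n with
  | zero =>
    intro V _ _ G h
    have := Nat.card_pos (α := V)
    omega
  | succ n ih =>
    intro V _ _ G h
    by_cases h1 : Nat.card V = 1
    · exact ⟨.single G h1, f.val G.red, le_rfl⟩
    · have h0 := Nat.card_pos (α := V)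
      have : Nontrivial V := Finite.one_lt_card_iff_nontrivial.1 (by omega)
      obtain ⟨u, v, huv⟩ := exists_pair_ne V
      obtain ⟨S, k, hS⟩ := ih (G.contract u v) (by
        have hlt : Nat.card {x : V // x ≠ u ∧ x ≠ v} < Nat.card {x : V // x ≠ u} :=
          Set.ncard_lt_ncard (s := {x | x ≠ u ∧ x ≠ v}) (t := {x | x ≠ u})
            ⟨fun x hx => hx.1, fun hx => (hx (a := v) huv.symm).2 rfl⟩ (Set.toFinite _)
        have hlt' : Nat.card {x : V // x ≠ u} < Nat.card V := by
          rw [← Nat.card_univ (α := V)]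
          exact Set.ncard_lt_ncard (s := {x | x ≠ u}) (t := Set.univ)
            ⟨fun x _ => trivial, fun hx => hx (a := u) trivial rfl⟩ (Set.toFinite _)
        rw [Finite.card_option]
        omega)
      exact ⟨.step G u v huv S, max (f.val G.red) k, le_max_left _ _,
        hS.weaken (le_max_right _ _)⟩

theorem exists_redAtMost_reducedVal (f : GraphParameter) {V : Type} [Finite V] [Nonempty V]
    (G : SimpleGraph V) :
    ∃ S : ReductionSequence (Trigraph.ofGraph G), S.RedAtMost f (reducedVal f G) := by
  obtain ⟨S, k, hS⟩ := exists_reductionSequence f _ (Trigraph.ofGraph G) le_rfl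
  exact Nat.sInf_mem (s := {k : ℕ | ∃ S : ReductionSequence (Trigraph.ofGraph G),
    S.RedAtMost f k}) ⟨k, S, hS⟩

theorem functionallyBounded_reduced {f g : GraphParameter} {h : ℕ → ℕ} (hh : Monotone h)
    (hfg : ∀ {V : Type} [Finite V] [Nonempty V] (G : SimpleGraph V), f.val G ≤ h (g.val G)) :
    FunctionallyBounded (reduced f) (reduced g) := by
  refine ⟨h, fun V _ _ G => ?_⟩
  obtain ⟨S, hS⟩ := exists_redAtMost_reducedVal g G
  exact Nat.sInf_le ⟨S, hS.mono hh hfg⟩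

/-! ### Quotient trigraphs -/

/-- `T` is the trigraph obtained from the graph `G` by identifying the fibres of `π`. -/
structure IsQuotient {V W : Type} (G : SimpleGraph V) (π : V → W) (T : Trigraph W) : Prop where
  surj : Function.Surjective π
  black_adj : ∀ a b, T.black.Adj a b ↔ a ≠ b ∧ ∀ x y, π x = a → π y = b → G.Adj x y
  red_adj : ∀ a b, T.red.Adj a b ↔ a ≠ b ∧ (∃ x y, π x = a ∧ π y = b ∧ G.Adj x y) ∧
    ∃ x y, π x = a ∧ π y = b ∧ ¬ G.Adj x y

theorem isQuotient_ofGraph {V : Type} (G : SimpleGraph V) :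
    IsQuotient G id (Trigraph.ofGraph G) where
  surj := Function.surjective_id
  black_adj a b := by
    simp only [Trigraph.ofGraph, id]
    exact ⟨fun h => ⟨h.ne, fun x y hx hy => hx ▸ hy ▸ h⟩, fun h => h.2 a b rfl rfl⟩
  red_adj a b := by
    simp only [Trigraph.ofGraph, id, bot_adj, false_iff]
    rintro ⟨-, ⟨x, y, rfl, rfl, h⟩, x', y', rfl, rfl, h'⟩
    exact h' h

theorem IsQuotient.total_adj {V W : Type} {G : SimpleGraph V} {π : V → W} {T : Trigraph W}
    (h : IsQuotient G π T) (a b : W) :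
    T.total.Adj a b ↔ a ≠ b ∧ ∃ x y, π x = a ∧ π y = b ∧ G.Adj x y := by
  obtain ⟨x, rfl⟩ := h.surj a
  obtain ⟨y, rfl⟩ := h.surj b
  simp only [Trigraph.total, sup_adj, h.black_adj, h.red_adj]
  constructor
  · rintro (h' | h')
    · exact ⟨h'.1, x, y, rfl, rfl, h'.2 x y rfl rfl⟩
    · exact ⟨h'.1, h'.2.1⟩
  · rintro ⟨h1, h2⟩
    by_cases h3 : ∀ x' y', π x' = π x → π y' = π y → G.Adj x' y'
    · exact .inl ⟨h1, h3⟩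
    · push Not at h3
      exact .inr ⟨h1, h2, h3⟩

open Classical in
/-- The projection from the vertices of a trigraph to those of `G/u,v`. -/
noncomputable def contractProj {W : Type} (u v : W) (x : W) : Option {x : W // x ≠ u ∧ x ≠ v} :=
  if h : x ≠ u ∧ x ≠ v then some ⟨x, h⟩ else none

theorem contractProj_eq_none {W : Type} {u v x : W} :
    contractProj u v x = none ↔ x = u ∨ x = v := by
  unfold contractProj
  split_ifs with h
  · simp [h.1, h.2]
  · simp only [true_iff]
    tauto

theorem contractProj_eq_some {W : Type} {u v x : W} {y : {x : W // x ≠ u ∧ x ≠ v}} :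
    contractProj u v x = some y ↔ x = y := by
  unfold contractProj
  split_ifs with h
  · simp [Subtype.ext_iff]
  · simp only [false_iff]
    rintro rfl
    exact h y.2

theorem contractProj_eq_iff {W : Type} {u v x y : W} :
    contractProj u v x = contractProj u v y ↔
      x = y ∨ ((x = u ∨ x = v) ∧ (y = u ∨ y = v)) := by
  rcases hy : contractProj u v y with _ | b
  · rw [contractProj_eq_none] at hy ⊢
    grind
  · rw [contractProj_eq_some] at hy ⊢
    have := b.2
    grind

/-- With this, the red edges at any stage can be read off from `G` and the current partition,
without regard to the order of the contractions: a red edge means that both an edge and a non-edge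
run between the two parts. -/
theorem IsQuotient.contract {V W : Type} {G : SimpleGraph V} {π : V → W} {T : Trigraph W}
    (h : IsQuotient G π T) (u v : W) :
    IsQuotient G (contractProj u v ∘ π) (T.contract u v) where
  surj := by
    rintro (_ | ⟨b, hb⟩)
    · obtain ⟨x, hx⟩ := h.surj u
      exact ⟨x, contractProj_eq_none.2 (.inl hx)⟩
    · obtain ⟨x, hx⟩ := h.surj b
      exact ⟨x, contractProj_eq_some.2 hx⟩
  black_adj := by
    rintro (_ | ⟨a, ha⟩) (_ | ⟨b, hb⟩) <;>
      simp only [Trigraph.contract, h.black_adj, Function.comp, contractProj_eq_none,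
        contractProj_eq_some, ne_eq, reduceCtorEq, not_false_eq_true, true_and, not_true_eq_false,
        false_and, Option.some.injEq, Subtype.mk.injEq]
    · constructor
      · rintro ⟨⟨-, h1⟩, -, h2⟩ x y (hx | hx) hy
        exacts [h1 x y hx hy, h2 x y hx hy]
      · exact fun h' => ⟨⟨fun e => hb.1 e.symm, fun x y hx hy => h' x y (.inl hx) hy⟩,
          fun e => hb.2 e.symm, fun x y hx hy => h' x y (.inr hx) hy⟩
    · constructor
      · rintro ⟨⟨-, h1⟩, -, h2⟩ x y hx (hy | hy)
        exacts [(h1 y x hy hx).symm, (h2 y x hy hx).symm]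
      · exact fun h' => ⟨⟨fun e => ha.1 e.symm, fun x y hx hy => (h' y x hy (.inl hx)).symm⟩,
          fun e => ha.2 e.symm, fun x y hx hy => (h' y x hy (.inr hx)).symm⟩
  red_adj := by
    rintro (_ | ⟨a, ha⟩) (_ | ⟨b, hb⟩) <;>
      simp only [Trigraph.contract, h.black_adj, h.red_adj, h.total_adj, Function.comp,
        contractProj_eq_none, contractProj_eq_some, ne_eq, reduceCtorEq, not_false_eq_true,
        true_and, not_true_eq_false, false_and, Option.some.injEq, Subtype.mk.injEq]
    · have h1 : ¬ u = b := fun e => hb.1 e.symm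
      have h2 : ¬ v = b := fun e => hb.2 e.symm
      simp only [h1, h2, not_false_eq_true, true_and]
      grind
    · have h1 : ¬ u = a := fun e => ha.1 e.symm
      have h2 : ¬ v = a := fun e => ha.2 e.symm
      have := fun x y => G.adj_comm x y
      simp only [h1, h2, not_false_eq_true, true_and]
      grind

/-! ### The product with a large clique forces red subgraphs -/

section LowerBound

variable {U W : Type} {H : SimpleGraph U} {n : ℕ}
  {π : U × Fin n → W} {T : Trigraph W}

/-- Assign to each part of the clique of `h'` a part of the clique of `h` that shares a column with
it. The fibre over `P` has at most one element if `P` has a black edge into the clique of `h'`, and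
otherwise consists of red neighbours of `P`. -/
theorem ncard_parts_le_of_adj [Finite W] (hq : IsQuotient (H □ (⊤ : SimpleGraph (Fin n))) π T)
    (hp : ∀ x y, π x = π y → x.1 = y.1) {d : ℕ} (hd : maxDeg T.red ≤ d) {h h' : U}
    (hh : H.Adj h h') :
    (Set.range fun i => π (h', i)).ncard ≤ (d + 1) * (Set.range fun i => π (h, i)).ncard := by
  classical
  let _ := Fintype.ofFinite W
  have hi : ∀ Q : W, ∃ P, Q ∈ Set.range (fun i => π (h', i)) →
      ∃ i, π (h, i) = P ∧ π (h', i) = Q := by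
    intro Q
    by_cases hQ : Q ∈ Set.range (fun i => π (h', i))
    · obtain ⟨i, hi⟩ := hQ
      exact ⟨π (h, i), fun _ => ⟨i, rfl, hi⟩⟩
    · exact ⟨Q, fun h => absurd h hQ⟩
  choose g hg using hi
  rw [Set.ncard_eq_toFinset_card', Set.ncard_eq_toFinset_card']
  refine Finset.card_le_mul_card_image_of_maps_to (f := g) (fun Q hQ => ?_) _ fun P _ => ?_
  · obtain ⟨i, hi, -⟩ := hg Q (by simpa using hQ)
    simpa using ⟨i, hi⟩
  -- A black edge from `P` to the part of `(h', i₀)` forces `P` to be the single vertex `(h, i₀)`,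
  -- since `(h, i)` is adjacent to `(h', i₀)` only for `i = i₀`.
  · by_cases hb : ∃ i₀, T.black.Adj P (π (h', i₀))
    · obtain ⟨i₀, hi₀⟩ := hb
      refine (Finset.card_le_card (t := {π (h', i₀)}) fun Q hQ => ?_).trans (by simp)
      simp only [Finset.mem_filter, Set.mem_toFinset] at hQ
      obtain ⟨i, hiP, hiQ⟩ := hg Q hQ.1
      have := ((hq.black_adj _ _).1 hi₀).2 (h, i) (h', i₀) (hiP.trans hQ.2) rfl
      rw [boxProd_adj] at this
      rcases this with ⟨-, h1⟩ | ⟨-, h1⟩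
      · have h1 : i = i₀ := h1
        rw [Finset.mem_singleton, ← hiQ, h1]
      · exact absurd h1 hh.ne
    · refine le_trans ?_ ((maxDeg_le_iff.1 hd P).trans (Nat.le_succ d))
      rw [Set.ncard_eq_toFinset_card']
      refine Finset.card_le_card fun Q hQ => ?_
      simp only [Finset.mem_filter, Set.mem_toFinset] at hQ ⊢
      obtain ⟨i, hiP, hiQ⟩ := hg Q hQ.1
      rw [hQ.2] at hiP
      have ht : T.total.Adj P Q := (hq.total_adj _ _).2
        ⟨fun e => hh.ne (hp (h, i) (h', i) (by rw [hiP, hiQ, e])), (h, i), (h', i), hiP, hiQ,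
          boxProd_adj.2 (.inl ⟨hh, rfl⟩)⟩
      rcases ht with ht | ht
      · exact absurd ⟨i, hiQ.symm ▸ ht⟩ hb
      · exact ht

/-- A part of the clique of `h` other than `u` and the part of `(h, b)` is joined to `u`, and is not
completely joined to `v`, because `(h', b)` has no neighbour `(h, i)` with `i ≠ b`. So it becomes a
red neighbour of the merged vertex; the two exceptions give `d + 2`. -/
theorem ncard_parts_le_of_contract [Finite W] (hq : IsQuotient (H □ (⊤ : SimpleGraph (Fin n))) π T)
    (hp : ∀ x y, π x = π y → x.1 = y.1) {d : ℕ} {h h' : U} (hh : h ≠ h') (a b : Fin n)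
    (hd : maxDeg (T.contract (π (h, a)) (π (h', b))).red ≤ d) :
    (Set.range fun i => π (h, i)).ncard ≤ d + 2 := by
  classical
  set u := π (h, a) with hu
  set v := π (h', b) with hv
  have key : (Set.range (fun i => π (h, i)) \ {u, π (h, b)}).ncard ≤ d := by
    refine le_trans ?_ (maxDeg_le_iff.1 hd none)
    refine Set.ncard_le_ncard_of_injOn (contractProj u v) ?_ ?_ (Set.toFinite _)
    · rintro _ ⟨⟨i, rfl⟩, hi⟩
      simp only [Set.mem_insert_iff, Set.mem_singleton_iff, not_or] at hi
      have h1 : π (h, i) ≠ v := fun e => hh (hp (h, i) (h', b) e)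
      have h2 : contractProj u v (π (h, i)) = some ⟨π (h, i), hi.1, h1⟩ :=
        contractProj_eq_some.2 rfl
      rw [mem_neighborSet]
      simp only [h2]
      have h3 : T.black.Adj u (π (h, i)) → ¬ T.black.Adj v (π (h, i)) := by
        intro _ h4
        have h5 := ((hq.black_adj _ _).1 h4).2 (h', b) (h, i) rfl rfl
        rw [boxProd_adj] at h5
        rcases h5 with ⟨-, h5⟩ | ⟨-, h5⟩
        · have h5 : b = i := h5
          exact hi.2 (by rw [h5])
        · exact hh h5.symm
      have h6 : T.total.Adj u (π (h, i)) := (hq.total_adj _ _).2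
        ⟨fun e => hi.1 e.symm, (h, a), (h, i), rfl, rfl,
          boxProd_adj.2 (.inr ⟨fun e : a = i => hi.1 (by rw [hu, e]), rfl⟩)⟩
      exact ⟨fun h7 => h3 h7.1 h7.2, fun h7 => h7.1 h6⟩
    · rintro x ⟨⟨i, rfl⟩, hi⟩ y - hxy
      simp only [Set.mem_insert_iff, Set.mem_singleton_iff, not_or] at hi
      rcases contractProj_eq_iff.1 hxy with h1 | ⟨h1 | h1, -⟩
      · exact h1
      · exact absurd h1 hi.1
      · exact absurd (hp (h, i) (h', b) h1) hh
  have h1 := Set.ncard_le_ncard_sdiff_add_ncard (Set.range fun i => π (h, i)) {u, π (h, b)}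
    (Set.toFinite _)
  have h2 := Set.ncard_insert_le u {π (h, b)}
  rw [Set.ncard_singleton] at h2
  omega

theorem ncard_parts_le_of_walk [Finite W] (hq : IsQuotient (H □ (⊤ : SimpleGraph (Fin n))) π T)
    (hp : ∀ x y, π x = π y → x.1 = y.1) {d : ℕ} (hd : maxDeg T.red ≤ d) {h h' : U}
    (w : H.Walk h h') :
    (Set.range fun i => π (h', i)).ncard ≤
      (d + 1) ^ w.length * (Set.range fun i => π (h, i)).ncard := by
  induction w with
  | nil => simp
  | cons hadj w ih =>
    refine ih.trans ?_
    rw [Walk.length_cons, pow_succ, mul_assoc]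
    exact Nat.mul_le_mul le_rfl (ncard_parts_le_of_adj hq hp hd hadj)

/-- In a column where every `(h, i)` shares its part with some `(h, i')`, each edge `(a, i)(b, i)`
is accompanied by the non-edge `(a, i')(b, i)` between the same parts, so it is red. -/
theorem exists_embedding_red_of_card_lt [Finite W]
    (hq : IsQuotient (H □ (⊤ : SimpleGraph (Fin n))) π T)
    (hp : ∀ x y, π x = π y → x.1 = y.1) (hn : Nat.card W < n) :
    ∃ φ : U → W, Function.Injective φ ∧ ∀ a b, H.Adj a b → T.red.Adj (φ a) (φ b) := by
  -- Otherwise each column contains a vertex that shares its part with no other vertex of its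
  -- clique. These `n` vertices lie in distinct parts, more than there are.
  obtain ⟨i, hi⟩ : ∃ i : Fin n, ∀ h, ∃ i', i' ≠ i ∧ π (h, i') = π (h, i) := by
    by_contra! hcon
    choose g hg using hcon
    have := Nat.card_le_card_of_injective (fun i => π (g i, i)) fun i j hij => by
      by_contra hne
      have h1 : g i = g j := hp _ _ hij
      exact hg i j (Ne.symm hne) (by simp only [h1] at hij ⊢; exact hij.symm)
    rw [Nat.card_fin] at this
    omega
  refine ⟨fun h => π (h, i), fun a b hab => hp _ _ hab, fun a b hab => ?_⟩
  obtain ⟨i', hi', he⟩ := hi a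
  refine (hq.red_adj _ _).2 ⟨fun e => hab.ne (hp _ _ e),
    ⟨(a, i), (b, i), rfl, rfl, boxProd_adj.2 (.inl ⟨hab, rfl⟩)⟩,
    (a, i'), (b, i), he, rfl, fun h => ?_⟩
  rw [boxProd_adj] at h
  rcases h with ⟨-, h⟩ | ⟨-, h⟩
  · exact hi' h
  · exact hab.ne h

theorem card_le_of_ncard_parts_le [Finite U] [Finite W] {M : ℕ} (hs : Function.Surjective π)
    (hM : ∀ h, (Set.range fun i => π (h, i)).ncard ≤ M) : Nat.card W ≤ Nat.card U * M := by
  classical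
  let _ := Fintype.ofFinite W
  let _ := Fintype.ofFinite U
  have : (Finset.univ : Finset W) ⊆
      Finset.univ.biUnion fun h : U => (Set.range fun i => π (h, i)).toFinset := by
    intro w _
    obtain ⟨⟨h, i⟩, rfl⟩ := hs w
    simp only [Finset.mem_biUnion, Finset.mem_univ, true_and, Set.mem_toFinset]
    exact ⟨h, i, rfl⟩
  rw [Nat.card_eq_fintype_card, Nat.card_eq_fintype_card]
  refine (Finset.card_le_card this).trans (Finset.card_biUnion_le_card_mul _ _ _ fun h _ => ?_)
  rw [← Set.ncard_eq_toFinset_card']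
  exact hM h

end LowerBound

/-- Induction along the sequence, as long as every part stays inside one clique. The final
one-vertex trigraph violates this because `U` is nontrivial, so a first violating contraction
occurs; the counting is done just before it. -/
theorem val_le_of_redAtMost {f : GraphParameter} (hf : f.IsMonotone) {k d : ℕ}
    (hd : ∀ {V : Type} [Finite V] [Nonempty V] (G : SimpleGraph V), f.val G ≤ k → maxDeg G ≤ d)
    {U : Type} [Finite U] [Nontrivial U] {H : SimpleGraph U} (hH : H.Connected) {n : ℕ}
    (hn : Nat.card U * ((d + 1) ^ Nat.card U * (d + 2)) < n)
    {W : Type} [Finite W] [Nonempty W] {T : Trigraph W} (S : ReductionSequence T) :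
    S.RedAtMost f k → ∀ π : U × Fin n → W, IsQuotient (H □ (⊤ : SimpleGraph (Fin n))) π T →
      (∀ x y, π x = π y → x.1 = y.1) → f.val H ≤ k := by
  classical
  induction S with
  | single G h =>
    intro _ π _ hp
    obtain ⟨a, b, hab⟩ := exists_pair_ne U
    have := (Nat.card_eq_one_iff_unique.1 h).1
    have i : Fin n := ⟨0, by omega⟩
    exact absurd (hp (a, i) (b, i) (Subsingleton.elim _ _)) hab
  | @step W _ _ T u v huv S ih =>
    intro hS π hq hp
    by_cases hp' : ∀ x y, (contractProj u v ∘ π) x = (contractProj u v ∘ π) y → x.1 = y.1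
    · exact ih hS.2 _ (hq.contract u v) hp'
    · push Not at hp'
      obtain ⟨x, y, hxy, hne⟩ := hp'
      have hred : f.val (T.contract u v).red ≤ k := by
        cases S with
        | single => exact hS.2
        | step => exact hS.2.1
      obtain ⟨h, h', a, b, hhh, rfl, rfl⟩ : ∃ (h h' : U) (a b : Fin n), h ≠ h' ∧ π (h, a) = u ∧
          π (h', b) = v := by
        rcases contractProj_eq_iff.1 hxy with h1 | ⟨h1 | h1, h2 | h2⟩
        · exact absurd (hp x y h1) hne
        · exact absurd (hp x y (h1.trans h2.symm)) hne
        · exact ⟨x.1, y.1, x.2, y.2, hne, h1, h2⟩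
        · exact ⟨y.1, x.1, y.2, x.2, hne.symm, h2, h1⟩
        · exact absurd (hp x y (h1.trans h2.symm)) hne
      have h0 := ncard_parts_le_of_contract hq hp hhh a b (hd _ hred)
      have hM : ∀ g, (Set.range fun i => π (g, i)).ncard ≤ (d + 1) ^ Nat.card U * (d + 2) := by
        intro g
        let _ := Fintype.ofFinite U
        obtain ⟨w⟩ := hH.preconnected h g
        have hl := w.toPath.2.length_lt
        rw [← Nat.card_eq_fintype_card] at hl
        refine (ncard_parts_le_of_walk hq hp (hd _ hS.1) w.toPath.1).trans ?_
        exact Nat.mul_le_mul (Nat.pow_le_pow_right (by omega) hl.le) h0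
      obtain ⟨φ, hφ, hφ'⟩ := exists_embedding_red_of_card_lt hq hp
        ((card_le_of_ncard_parts_le hq.surj hM).trans_lt hn)
      exact (hf H T.red φ hφ hφ').trans hS.1

/-- The reduced parameter of the product of a connected graph `H` with a large clique is at
least the value of the parameter at `H`. -/
theorem exists_val_le_reducedVal_boxProd {f : GraphParameter} (hf : f.IsMonotone)
    (hd : ∀ {V : Type} [Finite V] [Nonempty V] (G : SimpleGraph V), maxDeg G ≤ 2 * f.val G)
    {U : Type} [Finite U] [Nontrivial U] {H : SimpleGraph U} (hH : H.Connected) :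
    ∃ n : ℕ, f.val H ≤ (reduced f).val (H □ (⊤ : SimpleGraph (Fin (n + 1)))) := by
  -- If the claim fails, every red graph has `f` below `f.val H`, hence maximum degree at most this
  -- `d`.
  let d := 2 * f.val H
  refine ⟨Nat.card U * ((d + 1) ^ Nat.card U * (d + 2)), ?_⟩
  by_contra! hlt
  obtain ⟨S, hS⟩ := exists_redAtMost_reducedVal f
    (H □ (⊤ : SimpleGraph (Fin (Nat.card U * ((d + 1) ^ Nat.card U * (d + 2)) + 1))))
  refine absurd (val_le_of_redAtMost hf (d := d) (fun G hG => (hd G).trans ?_) hH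
    (Nat.lt_succ_self _) S hS id (isQuotient_ofGraph _) fun x y h => congrArg Prod.fst h)
    (not_le.2 hlt)
  exact Nat.mul_le_mul le_rfl (hG.trans hlt.le)

/-! ### Elimination orders -/

/-- Move an element to its parent until its rank is less than `t`. -/
def retract {V : Type} (rk : V → ℕ) (p : V → V) (t : ℕ) (x : V) : V :=
  if _h : t ≤ rk x ∧ rk (p x) < rk x then retract rk p t (p x) else x
termination_by rk x
decreasing_by exact _h.2

section Retract

variable {V : Type} {rk : V → ℕ} {p : V → V}

theorem retract_of_lt {t : ℕ} {x : V} (h : rk x < t) : retract rk p t x = x := by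
  rw [retract, dif_neg]
  omega

theorem retract_of_le (hp : ∀ x, rk x ≠ 0 → rk (p x) < rk x) {t : ℕ} (ht : 1 ≤ t) {x : V}
    (h : t ≤ rk x) : retract rk p t x = retract rk p t (p x) := by
  rw [retract, dif_pos ⟨h, hp x (by omega)⟩]

theorem rank_induction (hp : ∀ x, rk x ≠ 0 → rk (p x) < rk x) {t : ℕ} (ht : 1 ≤ t)
    {P : V → Prop} (h1 : ∀ x, rk x < t → P x) (h2 : ∀ x, t ≤ rk x → P (p x) → P x) (x : V) :
    P x := by
  induction hn : rk x using Nat.strong_induction_on generalizing x with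
  | _ n ih =>
    by_cases h : rk x < t
    · exact h1 x h
    · have := hp x (by omega)
      exact h2 x (by omega) (ih _ (hn ▸ this) _ rfl)

theorem rank_retract_lt (hp : ∀ x, rk x ≠ 0 → rk (p x) < rk x) {t : ℕ} (ht : 1 ≤ t) (x : V) :
    rk (retract rk p t x) < t := by
  induction x using rank_induction hp ht with
  | h1 x h => rwa [retract_of_lt h]
  | h2 x h ih => rwa [retract_of_le hp ht h]

theorem retract_retract (hp : ∀ x, rk x ≠ 0 → rk (p x) < rk x) {s t : ℕ} (ht : 1 ≤ t)
    (hts : t ≤ s) (x : V) : retract rk p t (retract rk p s x) = retract rk p t x := by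
  induction x using rank_induction hp (ht.trans hts) with
  | h1 x h => rw [retract_of_lt h]
  | h2 x h ih => rw [retract_of_le hp (ht.trans hts) h, ih, retract_of_le hp ht (hts.trans h)]

/-- Contracting the vertices into their parents, from the highest rank down to the lowest, is a
reduction sequence. -/
theorem exists_redAtMost_of_elimination [Finite V] [Nonempty V] {f : GraphParameter}
    (hf : f.IsMonotone) {G : SimpleGraph V} (hrk : Function.Injective rk)
    (hp : ∀ x, rk x ≠ 0 → rk (p x) < rk x) {k : ℕ}
    (hX : ∀ t, 1 ≤ t → ∃ X : SimpleGraph V, f.val X ≤ k ∧ ∀ x y, G.Adj x y →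
      retract rk p t x ≠ retract rk p t y →
      (∃ x' y', retract rk p t x' = retract rk p t x ∧ retract rk p t y' = retract rk p t y ∧
        ¬ G.Adj x' y') → X.Adj (retract rk p t x) (retract rk p t y)) :
    ∀ t {W : Type} [Finite W] [Nonempty W] (T : Trigraph W) (π : V → W), IsQuotient G π T →
      (∀ x y, π x = π y ↔ retract rk p (t + 1) x = retract rk p (t + 1) y) →
      ∃ S : ReductionSequence T, S.RedAtMost f k := by
  intro t
  -- Each part is represented by the common retract of its elements, which embeds the red graph into
  -- `X`.
  have hred : ∀ t {W : Type} [Finite W] [Nonempty W] (T : Trigraph W) (π : V → W),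
      IsQuotient G π T →
      (∀ x y, π x = π y ↔ retract rk p (t + 1) x = retract rk p (t + 1) y) →
      f.val T.red ≤ k := by
    intro t W _ _ T π hq hπ
    obtain ⟨X, hXk, hX⟩ := hX (t + 1) (by omega)
    choose g hg using hq.surj
    refine (hf T.red X (fun a => retract rk p (t + 1) (g a)) (fun a b hab => ?_)
      fun a b hab => ?_).trans hXk
    · rw [← hg a, ← hg b]
      exact (hπ _ _).2 hab
    · obtain ⟨hne, ⟨x, y, hx, hy, hxy⟩, x', y', hx', hy', hxy'⟩ := (hq.red_adj _ _).1 hab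
      rw [← (hπ x _).1 (hx.trans (hg a).symm), ← (hπ y _).1 (hy.trans (hg b).symm)]
      refine hX x y hxy (fun e => hne ?_) ⟨x', y', ?_, ?_, hxy'⟩
      · rw [← hx, ← hy, (hπ x y).2 e]
      · exact (hπ _ _).1 (hx'.trans hx.symm)
      · exact (hπ _ _).1 (hy'.trans hy.symm)
  induction t with
  | zero =>
    intro W _ _ T π hq hπ
    -- With threshold `1` every retract has rank `0`, and the rank is injective.
    have hs : Subsingleton W := ⟨fun a b => ?_⟩
    · exact ⟨.single T (Nat.card_eq_one_iff_unique.2 ⟨hs, inferInstance⟩),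
        show f.val T.red ≤ k from hred _ T π hq hπ⟩
    obtain ⟨x, rfl⟩ := hq.surj a
    obtain ⟨y, rfl⟩ := hq.surj b
    refine (hπ x y).2 (hrk ?_)
    have h1 := rank_retract_lt hp le_rfl x
    have h2 := rank_retract_lt hp le_rfl y
    simp only [zero_add]
    omega
  | succ t ih =>
    intro W _ _ T π hq hπ
    have hrr := fun x => retract_retract hp (s := t + 1 + 1) (t := t + 1) (by omega) (by omega) x
    have hlt := fun x => rank_retract_lt hp (t := t + 1 + 1) (by omega) x
    by_cases hz : ∃ z, rk z = t + 1
    · obtain ⟨z, hz⟩ := hz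
      have hpz := hp z (by omega)
      have hz1 : retract rk p (t + 1 + 1) z = z := retract_of_lt (by omega)
      have hz2 : retract rk p (t + 1 + 1) (p z) = p z := retract_of_lt (by omega)
      have hne : z ≠ p z := fun e => by rw [← e] at hpz; exact lt_irrefl _ hpz
      have hπz : ∀ x, π x = π z ↔ retract rk p (t + 1 + 1) x = z := fun x => by rw [hπ, hz1]
      have hπp : ∀ x, π x = π (p z) ↔ retract rk p (t + 1 + 1) x = p z := fun x => by rw [hπ, hz2]
      obtain ⟨S, hS⟩ := ih (T.contract (π z) (π (p z))) _ (hq.contract _ _) (by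
        intro x y
        have hev : ∀ a, rk a < t + 1 + 1 →
            a = z ∧ retract rk p (t + 1) a = p z ∨
              a ≠ z ∧ retract rk p (t + 1) a = a := by
          intro a ha
          by_cases haz : a = z
          · subst haz
            exact .inl ⟨rfl, by
              rw [retract_of_le hp (by omega) (by omega), retract_of_lt (by omega)]⟩
          · refine .inr ⟨haz, retract_of_lt ?_⟩
            have : rk a ≠ rk z := fun e => haz (hrk e)
            omega
        have hx := hev _ (hlt x)
        have hy := hev _ (hlt y)
        simp only [Function.comp, contractProj_eq_iff, hπz, hπp, hπ x y]
        rw [hrr] at hx hy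
        grind)
      have hne' : π z ≠ π (p z) := fun e => hne (by rw [hπ, hz1, hz2] at e; exact e)
      exact ⟨.step T (π z) (π (p z)) hne' S,
        show f.val T.red ≤ k ∧ S.RedAtMost f k from ⟨hred _ T π hq hπ, hS⟩⟩
    -- The ranks may have gaps; if no element has rank `t + 1`, the partition does not change and
    -- nothing is contracted.
    · refine ih T π hq fun x y => ?_
      have hev : ∀ x, retract rk p (t + 1) x = retract rk p (t + 1 + 1) x := fun x => by
        rw [← hrr]
        refine retract_of_lt ?_
        have := hlt x
        have h2 : rk (retract rk p (t + 1 + 1) x) ≠ t + 1 := fun e => hz ⟨_, e⟩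
        omega
      rw [hπ, hev, hev]

theorem reducedVal_le_of_elimination [Finite V] [Nonempty V] {f : GraphParameter}
    (hf : f.IsMonotone) {G : SimpleGraph V} (hrk : Function.Injective rk)
    (hp : ∀ x, rk x ≠ 0 → rk (p x) < rk x) {k : ℕ}
    (hX : ∀ t, 1 ≤ t → ∃ X : SimpleGraph V, f.val X ≤ k ∧ ∀ x y, G.Adj x y →
      retract rk p t x ≠ retract rk p t y →
      (∃ x' y', retract rk p t x' = retract rk p t x ∧ retract rk p t y' = retract rk p t y ∧
        ¬ G.Adj x' y') → X.Adj (retract rk p t x) (retract rk p t y)) :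
    (reduced f).val G ≤ k := by
  obtain ⟨N, hN⟩ := (Set.finite_range rk).bddAbove
  refine Nat.sInf_le (exists_redAtMost_of_elimination hf hrk hp hX N _ id
    (isQuotient_ofGraph G) fun x y => ?_)
  have h : ∀ x, rk x < N + 1 := fun x => Nat.lt_succ_of_le (hN ⟨x, rfl⟩)
  rw [retract_of_lt (h x), retract_of_lt (h y)]
  rfl

end Retract

/-! ### Products with cliques -/

/-- Two copies of `Y`, with all edges between copies of adjacent vertices, in the columns `0` and
`j` of `U × Fin n`. -/
def twoColumns {U : Type} (Y : SimpleGraph U) (n j : ℕ) : SimpleGraph (U × Fin n) where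
  Adj x y := Y.Adj x.1 y.1 ∧ ((x.2 : ℕ) = 0 ∨ (x.2 : ℕ) = j) ∧ ((y.2 : ℕ) = 0 ∨ (y.2 : ℕ) = j)
  symm := ⟨fun _ _ h => ⟨h.1.symm, h.2.2, h.2.1⟩⟩
  loopless := ⟨fun _ h => h.1.ne rfl⟩

/-- The parent of a vertex of `U × Fin (n + 1)`: first move to column `0`, and then move to the
parent in `U`. -/
def columnParent {U : Type} (p : U → U) {n : ℕ} (x : U × Fin (n + 1)) : U × Fin (n + 1) :=
  if x.2 = 0 then (p x.1, 0) else (x.1, 0)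

/-- The host `Y` must contain every graph obtained from `H` by retracting along `p`. The clique
direction contributes no red edge, which is why the bound does not depend on `n`. -/
theorem reducedVal_boxProd_le {U : Type} [Finite U] [Nonempty U] {f : GraphParameter}
    (hf : f.IsMonotone) {H Y : SimpleGraph U} {rk : U → ℕ} {p : U → U}
    (hrk : Function.Injective rk) (hp : ∀ x, rk x ≠ 0 → rk (p x) < rk x)
    (hY : ∀ t, 1 ≤ t → ∀ a b, H.Adj a b → retract rk p t a ≠ retract rk p t b →
      Y.Adj (retract rk p t a) (retract rk p t b)) (n k : ℕ)
    (hk : ∀ j, f.val (twoColumns Y (n + 1) j) ≤ k) :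
    (reduced f).val (H □ (⊤ : SimpleGraph (Fin (n + 1)))) ≤ k := by
  obtain ⟨N, hN⟩ : ∃ N, ∀ x, rk x < N := by
    obtain ⟨N, hN⟩ := (Set.finite_range rk).bddAbove
    exact ⟨N + 1, fun x => Nat.lt_succ_of_le (hN ⟨x, rfl⟩)⟩
  have hN0 : 1 ≤ N := by
    obtain ⟨x⟩ := ‹Nonempty U›
    have := hN x
    omega
  have hHY : ∀ a b, H.Adj a b → Y.Adj a b := fun a b hab => by
    have := hY N hN0 a b hab
    rw [retract_of_lt (hN a), retract_of_lt (hN b)] at this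
    exact this hab.ne
  -- Column by column, with `N` a strict bound on the ranks in `U`. Thresholds above `N` merge
  -- columns, the one in progress being `t / N`; thresholds up to `N` contract column `0`.
  let rk' : U × Fin (n + 1) → ℕ := fun x => x.2 * N + rk x.1
  have hrk0 : ∀ x : U × Fin (n + 1), (x.2 : ℕ) = 0 → rk' x = rk x.1 := fun x hx => by
    simp [rk', hx]
  have hrk1 : ∀ x : U × Fin (n + 1), (x.2 : ℕ) ≠ 0 → N ≤ rk' x := fun x hx => by
    have : 1 * N ≤ x.2 * N := Nat.mul_le_mul (by omega) le_rfl
    simp only [rk']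
    omega
  have hdiv : ∀ x, rk' x / N = x.2 := fun x => by
    simp only [rk']
    rw [mul_comm, Nat.mul_add_div (by omega), Nat.div_eq_of_lt (hN _), add_zero]
  have hinj : Function.Injective rk' := by
    rintro ⟨a, i⟩ ⟨b, j⟩ hab
    have h1 : i = j := Fin.ext (by rw [← hdiv (a, i), ← hdiv (b, j), hab])
    subst h1
    have h2 : rk a = rk b := by simpa [rk'] using hab
    rw [hrk h2]
  have hp' : ∀ x, rk' x ≠ 0 → rk' (columnParent p x) < rk' x := by
    intro x hx
    by_cases h : x.2 = 0
    · have h0 : (x.2 : ℕ) = 0 := by simp [h]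
      rw [columnParent, if_pos h, hrk0 _ rfl, hrk0 _ h0]
      exact hp _ (by rwa [hrk0 _ h0] at hx)
    · have h0 : (x.2 : ℕ) ≠ 0 := fun e => h (Fin.ext e)
      rw [columnParent, if_neg h, hrk0 _ rfl]
      exact (hN _).trans_le (hrk1 x h0)
  refine reducedVal_le_of_elimination hf hinj hp' fun t ht => ?_
  rcases le_total t N with htN | htN
  · refine ⟨twoColumns Y (n + 1) 0, hk 0, ?_⟩
    have hr0 : ∀ a : U, retract rk' (columnParent p) t (a, (0 : Fin (n + 1))) =
        (retract rk p t a, 0) := by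
      intro a
      induction a using rank_induction hp ht with
      | h1 a h => rw [retract_of_lt h, retract_of_lt (by rwa [hrk0 _ rfl])]
      | h2 a h ih =>
        rw [retract_of_le hp ht h, ← ih, retract_of_le hp' ht (by rwa [hrk0 _ rfl])]
        simp [columnParent]
    have hr : ∀ x : U × Fin (n + 1), retract rk' (columnParent p) t x =
        (retract rk p t x.1, 0) := by
      rintro ⟨a, i⟩
      by_cases h : i = 0
      · rw [h, hr0]
      · have h0 : (i : ℕ) ≠ 0 := fun e => h (Fin.ext e)
        rw [retract_of_le hp' ht (htN.trans (hrk1 (a, i) h0)), columnParent, if_neg h, hr0]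
    intro x y hxy hne _
    rw [hr, hr] at hne ⊢
    have hne' : retract rk p t x.1 ≠ retract rk p t y.1 := fun e => hne (by rw [e])
    rw [boxProd_adj] at hxy
    rcases hxy with ⟨hxy, -⟩ | ⟨-, hxy⟩
    · exact ⟨hY t ht _ _ hxy hne', .inl rfl, .inl rfl⟩
    · exact absurd (by rw [hxy]) hne'
  · refine ⟨twoColumns Y (n + 1) (t / N), hk _, ?_⟩
    have hr : ∀ x, rk' x < t ∧ retract rk' (columnParent p) t x = x ∨
        t ≤ rk' x ∧ retract rk' (columnParent p) t x = (x.1, 0) := by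
      intro x
      rcases lt_or_ge (rk' x) t with h | h
      · exact .inl ⟨h, retract_of_lt h⟩
      · refine .inr ⟨h, ?_⟩
        have h0 : x.2 ≠ 0 := fun e => by
          have := hrk0 x (by simp [e])
          have := hN x.1
          omega
        rw [retract_of_le hp' ht h, columnParent, if_neg h0, retract_of_lt]
        rw [hrk0 _ rfl]
        exact (hN _).trans_le htN
    have hr1 : ∀ x, (retract rk' (columnParent p) t x).1 = x.1 := fun x => by
      rcases hr x with ⟨-, h⟩ | ⟨-, h⟩ <;> rw [h]
    intro x y hxy hne hex
    rw [boxProd_adj] at hxy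
    rcases hxy with ⟨hxy, he⟩ | ⟨-, hxy⟩
    -- A column strictly between `0` and `t / N` is untouched: its vertices are singleton parts, so
    -- its edges are still black.
    · by_cases hi : (x.2 : ℕ) ≠ 0 ∧ (x.2 : ℕ) < t / N
      · obtain ⟨x', y', hx', hy', hna⟩ := hex
        have hlt : ∀ z : U × Fin (n + 1), z.2 = x.2 → rk' z < t := fun z hz => by
          by_contra hge
          have := Nat.div_le_div_right (c := N) (not_lt.1 hge)
          rw [hdiv, hz] at this
          omega
        have huniq : ∀ z z' : U × Fin (n + 1), z.2 = x.2 →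
            retract rk' (columnParent p) t z' = retract rk' (columnParent p) t z → z' = z := by
          intro z z' hz hzz
          rw [retract_of_lt (hlt z hz)] at hzz
          rcases hr z' with ⟨-, h⟩ | ⟨-, h⟩
          · rw [← h, hzz]
          · rw [h] at hzz
            exact absurd (by rw [← hz, ← hzz]; rfl) hi.1
        rw [huniq x x' rfl hx', huniq y y' he.symm hy'] at hna
        exact absurd (boxProd_adj.2 (.inl ⟨hxy, he⟩)) hna
      · have hcol : ∀ z : U × Fin (n + 1), z.2 = x.2 →
            ((retract rk' (columnParent p) t z).2 : ℕ) = 0 ∨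
            ((retract rk' (columnParent p) t z).2 : ℕ) = t / N := by
          intro z hz
          rcases hr z with ⟨hlt, h⟩ | ⟨-, h⟩
          · rw [h, hz]
            have := Nat.div_le_div_right (c := N) hlt.le
            rw [hdiv, hz] at this
            omega
          · rw [h]
            exact .inl rfl
        refine ⟨?_, hcol x rfl, hcol y he.symm⟩
        rw [hr1, hr1]
        exact hHY _ _ hxy
    -- Retraction keeps the first coordinate here, so both parts lie in the same clique and are
    -- completely joined.
    · obtain ⟨x', y', hx', hy', hna⟩ := hex
      refine absurd (boxProd_adj.2 (.inr ⟨?_, ?_⟩)) hna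
      · intro e
        apply hne
        have h1 : x'.1 = y'.1 := by
          rw [← hr1 x', ← hr1 y', hx', hy', hr1, hr1, hxy]
        rw [← hx', ← hy', Prod.ext h1 e]
      · rw [← hr1 x', ← hr1 y', hx', hy', hr1, hr1, hxy]

/-! ### Connected sets in trees and the sets of nodes that they meet -/

/-- The path from `r` to a vertex of a connected set `S` in a tree passes through the vertex of
`S` nearest to `r`, and stays in `S` from there on. -/
theorem isTree_gate {T : Type} {t : SimpleGraph T} (ht : t.IsTree) {S : Set T}
    (hS : (t.induce S).Connected) (r : T) {top : T} (htop : top ∈ S)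
    (hmin : ∀ s ∈ S, t.dist r top ≤ t.dist r s) {z : T} (hz : z ∈ S) (q : t.Walk r z)
    (hq : q.IsPath) :
    top ∈ q.support ∧ ∀ y ∈ q.support, t.dist r top ≤ t.dist r y → y ∈ S := by
  classical
  obtain ⟨q0, hq0, hl⟩ := ht.connected.exists_path_of_dist r top
  obtain ⟨w0⟩ := hS.preconnected ⟨top, htop⟩ ⟨z, hz⟩
  let w := w0.toPath
  let w' : t.Walk top z := w.1.map (Embedding.induce S).toHom
  have hw' : w'.IsPath := w.2.map Subtype.val_injective
  have hwS : ∀ y ∈ w'.support, y ∈ S := by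
    intro y hy
    have hsupp : w'.support = w.1.support.map (Embedding.induce S).toHom := Walk.support_map _ _
    rw [hsupp, List.mem_map] at hy
    obtain ⟨s, -, rfl⟩ := hy
    exact s.2
  have hq0top : ∀ y ∈ q0.support, t.dist r top ≤ t.dist r y → y = top := by
    intro y hy hd
    by_contra hne
    have h1 := Walk.length_takeUntil_lt_length hy hne
    have h2 := dist_le (q0.takeUntil y hy)
    omega
  -- On `q0` only `top` is as far from `r` as the vertices of `S`, so `q0` and the path inside `S`
  -- meet only in `top`. Uniqueness of paths then identifies `q` with their concatenation.
  have hpath : (q0.append w').IsPath := by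
    rw [Walk.isPath_def, Walk.support_append]
    refine List.nodup_append.2 ⟨hq0.support_nodup, hw'.support_nodup.tail, ?_⟩
    rintro a ha b hb rfl
    have h1 := hq0top a ha (hmin a (hwS a (List.mem_of_mem_tail hb)))
    have h2 := hw'.support_nodup
    rw [← Walk.cons_tail_support, List.nodup_cons] at h2
    exact h2.1 (h1 ▸ hb)
  have he : q = q0.append w' := (ht.existsUnique_path r z).unique hq hpath
  subst he
  refine ⟨?_, fun y hy hd => ?_⟩
  · exact Walk.mem_support_append_iff _ _ |>.2 (.inl q0.end_mem_support)
  · rcases (Walk.mem_support_append_iff _ _).1 hy with h | h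
    · exact hq0top y h hd ▸ htop
    · exact hwS y h

/-- The Helly property of subtrees of a tree. -/
theorem isTree_helly {T ι : Type} [Finite ι] [Nonempty ι] {t : SimpleGraph T} (ht : t.IsTree)
    (S : ι → Set T) (hS : ∀ i, (t.induce (S i)).Connected)
    (hSS : ∀ i j, (S i ∩ S j).Nonempty) : ∃ x, ∀ i, x ∈ S i := by
  obtain ⟨r⟩ := ht.connected.nonempty
  have hex : ∀ i, ∃ y ∈ S i, ∀ s ∈ S i, t.dist r y ≤ t.dist r s := by
    intro i
    obtain ⟨⟨s, hs⟩⟩ := (hS i).nonempty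
    obtain ⟨y, hy, hmin⟩ := (measure fun y => t.dist r y).wf.has_min (S i) ⟨s, hs⟩
    exact ⟨y, hy, fun s hs => not_lt.1 (hmin s hs)⟩
  choose top htop hmin using hex
  -- Take the subtree whose top is farthest from `r`. For a common node `z` with another subtree `S
  -- j`, this top lies on the path from `r` to `z`, no nearer to `r` than the top of `S j`, hence
  -- inside `S j`.
  obtain ⟨i, hi⟩ := Finite.exists_max fun i => t.dist r (top i)
  refine ⟨top i, fun j => ?_⟩
  obtain ⟨z, hzi, hzj⟩ := hSS i j
  obtain ⟨q, hq, -⟩ := ht.existsUnique_path r z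
  have h1 := (isTree_gate ht (hS i) r (htop i) (hmin i) hzi q hq).1
  exact (isTree_gate ht (hS j) r (htop j) (hmin j) hzj q hq).2 _ h1 (hi j)

namespace TreeDecomposition

variable {V T : Type} {G : SimpleGraph V}

/-- The nodes whose bags meet a given connected set form a connected set. -/
theorem connected_meets (D : TreeDecomposition G T) {B : Set V} (hB : (G.induce B).Connected) :
    (D.tree.induce {x | (D.bag x ∩ B).Nonempty}).Connected := by
  have hv : ∀ v (hv : v ∈ B) x y (hx : v ∈ D.bag x) (hy : v ∈ D.bag y),
      (D.tree.induce {x | (D.bag x ∩ B).Nonempty}).Reachable ⟨x, v, hx, hv⟩ ⟨y, v, hy, hv⟩ := by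
    intro v hv x y hx hy
    have hsub : {x | v ∈ D.bag x} ⊆ {x | (D.bag x ∩ B).Nonempty} := fun x hx => ⟨v, hx, hv⟩
    exact ((D.connected v).preconnected ⟨x, hx⟩ ⟨y, hy⟩).map (induceHomOfLE D.tree hsub).toHom
  have key : ∀ (u v : B) (_ : (G.induce B).Walk u v) x y (hx : u.1 ∈ D.bag x)
      (hy : v.1 ∈ D.bag y),
      (D.tree.induce {x | (D.bag x ∩ B).Nonempty}).Reachable
        ⟨x, u.1, hx, u.2⟩ ⟨y, v.1, hy, v.2⟩ := by
    intro u v w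
    induction w with
    | nil => exact fun x y hx hy => hv _ (Subtype.prop _) x y hx hy
    | @cons a b c hadj w ih =>
      intro x y hx hy
      obtain ⟨z, hz1, hz2⟩ := D.edge_mem a.1 b.1 hadj
      exact (hv _ a.2 x z hx hz1).trans (ih z y hz2 hy)
  refine (connected_iff _).2 ⟨?_, ?_⟩
  · rintro ⟨x, u, hxu, hu⟩ ⟨y, v, hyv, hv⟩
    obtain ⟨w⟩ := hB.preconnected ⟨u, hu⟩ ⟨v, hv⟩
    exact key ⟨u, hu⟩ ⟨v, hv⟩ w x y hxu hyv
  · obtain ⟨⟨v, hv⟩⟩ := hB.nonempty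
    obtain ⟨⟨x, hx⟩⟩ := (D.connected v).nonempty
    exact ⟨⟨x, v, hx, hv⟩⟩

theorem exists_bag_meets {ι : Type} [Finite ι] [Nonempty ι] (D : TreeDecomposition G T)
    (B : ι → Set V) (hB : ∀ i, (G.induce (B i)).Connected)
    (hBB : ∀ i j, (B i ∩ B j).Nonempty) : ∃ x, ∀ i, (D.bag x ∩ B i).Nonempty := by
  refine isTree_helly D.isTree _ (fun i => D.connected_meets (hB i)) fun i j => ?_
  obtain ⟨v, hi, hj⟩ := hBB i j
  obtain ⟨⟨x, hx⟩⟩ := (D.connected v).nonempty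
  exact ⟨x, ⟨v, hx, hi⟩, v, hx, hj⟩

/-- If the tree is a path, then the nodes whose bags meet a given connected set form an
interval. -/
theorem meets_of_between {n : ℕ} (D : TreeDecomposition G T) (e : D.tree ≃g pathGraph n)
    {B : Set V} (hB : (G.induce B).Connected) {x y z : T} (hx : (D.bag x ∩ B).Nonempty)
    (hz : (D.bag z ∩ B).Nonempty) (hxy : e x ≤ e y) (hyz : e y ≤ e z) :
    (D.bag y ∩ B).Nonempty := by
  by_contra hy
  have hne : ∀ a : {x | (D.bag x ∩ B).Nonempty}, e a.1 ≠ e y := fun a h =>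
    hy (e.injective h ▸ a.2)
  -- Adjacent nodes of the path differ by one in position, so a walk that avoids `y` cannot get past
  -- it.
  have key : ∀ a b : {x | (D.bag x ∩ B).Nonempty},
      (D.tree.induce {x | (D.bag x ∩ B).Nonempty}).Walk a b → e a.1 < e y → e b.1 < e y := by
    intro a b w
    induction w with
    | nil => exact id
    | @cons a b c hadj w ih =>
      intro ha
      have h1 : (pathGraph n).Adj (e a.1) (e b.1) := e.map_adj_iff.2 hadj
      rw [pathGraph_adj] at h1
      have h2 := hne b
      refine ih ?_
      rw [Fin.lt_def] at ha ⊢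
      rw [Ne, Fin.ext_iff] at h2
      omega
  obtain ⟨w⟩ := (D.connected_meets hB).preconnected ⟨x, hx⟩ ⟨z, hz⟩
  exact absurd (key _ _ w (lt_of_le_of_ne hxy (hne ⟨x, hx⟩))) (not_lt.2 hyz)

end TreeDecomposition

/-! ### Two columns -/

theorem maxDeg_twoColumns_le {U : Type} [Finite U] (Y : SimpleGraph U) (n j : ℕ) :
    maxDeg (twoColumns Y n j) ≤ 2 * maxDeg Y := by
  refine maxDeg_le_iff.2 fun x => ?_
  have h1 := Set.ncard_le_ncard_of_injOn (s := (twoColumns Y n j).neighborSet x)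
    (t := Y.neighborSet x.1 ×ˢ ({0, j} : Set ℕ)) (fun y => (y.1, (y.2 : ℕ)))
    (fun y hy => ⟨hy.1, by simpa using hy.2.2⟩)
    (fun y _ z _ hyz => by
      simp only [Prod.mk.injEq] at hyz
      exact Prod.ext hyz.1 (Fin.ext hyz.2)) (Set.toFinite _)
  rw [Set.ncard_prod] at h1
  have h2 := maxDeg_le_iff.1 (le_refl (maxDeg Y)) x.1
  have h3 : ({0, j} : Set ℕ).ncard ≤ 2 := by
    simpa using Set.ncard_insert_le 0 {j}
  calc _ ≤ _ := h1
    _ ≤ maxDeg Y * 2 := Nat.mul_le_mul h2 h3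
    _ = _ := mul_comm _ _

/-- Both copies of a vertex of `Y` inherit its interval. Vertices in the other columns are isolated
and receive private points `N + e x` beyond all those intervals. -/
theorem pathwidth_twoColumns_le {U : Type} [Finite U] (Y : SimpleGraph U) (l r : U → ℕ) (k : ℕ)
    (hlr : ∀ v, l v ≤ r v) (hadj : ∀ u v, Y.Adj u v → l u ≤ r v)
    (hk : ∀ p, {v | l v ≤ p ∧ p ≤ r v}.ncard ≤ k) (n j : ℕ) :
    pathwidth (twoColumns Y n j) ≤ 2 * k := by
  classical
  obtain ⟨N, hN⟩ : ∃ N, ∀ x, r x < N := by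
    obtain ⟨N, hN⟩ := (Set.finite_range r).bddAbove
    exact ⟨N + 1, fun x => Nat.lt_succ_of_le (hN ⟨x, rfl⟩)⟩
  let e := Finite.equivFin (U × Fin n)
  let P : U × Fin n → Prop := fun x => (x.2 : ℕ) = 0 ∨ (x.2 : ℕ) = j
  refine pathwidth_le_of_intervals _ (fun x => if P x then l x.1 else N + e x)
    (fun x => if P x then r x.1 else N + e x) _ (fun x => ?_) (fun x y hxy => ?_) fun p => ?_
  · split_ifs
    exacts [hlr _, le_rfl]
  · have hx : P x := hxy.2.1
    have hy : P y := hxy.2.2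
    simp only [hx, hy, if_true]
    exact hadj _ _ hxy.1
  · rcases lt_or_ge p N with hp | hp
    · have h1 := Set.ncard_le_ncard_of_injOn (s := {x | (if P x then l x.1 else N + e x) ≤ p ∧
          p ≤ if P x then r x.1 else N + e x})
        (t := {v | l v ≤ p ∧ p ≤ r v} ×ˢ ({0, j} : Set ℕ)) (fun y => (y.1, (y.2 : ℕ)))
        (fun y hy => by
          by_cases hPy : P y
          · simp only [Set.mem_ofPred_eq, hPy, if_true] at hy
            exact ⟨hy, by simpa using hPy⟩
          · simp only [Set.mem_ofPred_eq, hPy, if_false] at hy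
            omega)
        (fun y _ z _ hyz => by
          simp only [Prod.mk.injEq] at hyz
          exact Prod.ext hyz.1 (Fin.ext hyz.2)) (Set.toFinite _)
      rw [Set.ncard_prod] at h1
      have h3 : ({0, j} : Set ℕ).ncard ≤ 2 := by
        simpa using Set.ncard_insert_le 0 {j}
      have := Nat.mul_le_mul (hk p) h3
      omega
    · refine le_trans (Set.ncard_le_one (Set.toFinite _) |>.2 fun x hx y hy => ?_)
        (Nat.le_add_left _ _)
      have h1 := hN x.1
      have h2 := hN y.1
      simp only [Set.mem_ofPred_eq] at hx hy
      split_ifs at hx hy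
      · omega
      · omega
      · omega
      · exact e.injective (Fin.ext (by omega))

/-! ### Parent graphs -/

section ParentGraph

variable {U : Type} {rk : U → ℕ} {p : U → U}

/-- An element of rank at least `t` has the same retract as its parent. So an edge that is not
collapsed has both ends of rank below `t` and stays in place: a tree serves as its own host. -/
theorem parentGraph_retract_adj (hp : ∀ x, rk x ≠ 0 → rk (p x) < rk x)
    (hroot : ∀ x, rk x = 0 → p x = x) {t : ℕ} (ht : 1 ≤ t) {a b : U}
    (hab : (parentGraph p).Adj a b) (hne : retract rk p t a ≠ retract rk p t b) :
    (parentGraph p).Adj (retract rk p t a) (retract rk p t b) := by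
  have key : ∀ a, a ≠ p a → retract rk p t a ≠ retract rk p t (p a) →
      retract rk p t a = a ∧ retract rk p t (p a) = p a := by
    intro a ha hne
    by_cases h : rk a < t
    · have := hp a fun e => ha (hroot a e).symm
      exact ⟨retract_of_lt h, retract_of_lt (this.trans h)⟩
    · exact absurd (retract_of_le hp ht (not_lt.1 h)) hne
  have hab' := hab
  rw [parentGraph_adj] at hab'
  obtain ⟨h, rfl | rfl⟩ := hab'
  · rw [(key a h hne).1, (key a h hne).2]
    exact hab
  · rw [(key b h.symm hne.symm).1, (key b h.symm hne.symm).2]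
    exact hab

/-- The bag at `(a, 0)` holds the copies of `a` and `p a` in the two columns. Each `(a, i)` with `i
≠ 0` is also a leaf below `(a, 0)` with itself as its bag, which covers the isolated vertices. The
size bound `5` counts `2 * 2` copies and the node itself. -/
theorem treewidth_twoColumns_parentGraph_le [Finite U] (hp : ∀ x, rk x ≠ 0 → rk (p x) < rk x)
    {root : U} (hrk : ∀ x, rk x = 0 → x = root) (hroot : p root = root) (n j : ℕ) :
    treewidth (twoColumns (parentGraph p) (n + 1) j) ≤ 4 := by
  classical
  let bag : U × Fin (n + 1) → Set (U × Fin (n + 1)) := fun x => {v | v = x ∨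
    (x.2 = 0 ∧ (v.1 = x.1 ∨ v.1 = p x.1) ∧ ((v.2 : ℕ) = 0 ∨ (v.2 : ℕ) = j))}
  have hc0 : ∀ a : U, columnParent p (a, (0 : Fin (n + 1))) = (p a, 0) := fun a => by
    simp [columnParent]
  have hc1 : ∀ (a : U) (i : Fin (n + 1)), i ≠ 0 → columnParent p (a, i) = (a, 0) :=
    fun a i h => by simp [columnParent, h]
  let D : TreeDecomposition (twoColumns (parentGraph p) (n + 1) j) (U × Fin (n + 1)) :=
    { tree := parentGraph (columnParent p)
      isTree := by
        refine parentGraph_isTree _ (root, 0) (fun x => rk x.1 + if x.2 = 0 then 0 else 1) ?_ ?_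
        · rintro ⟨a, i⟩ hx
          by_cases h : i = 0
          · subst h
            have : rk a ≠ 0 := fun e => hx (by rw [hrk a e])
            simpa [hc0] using hp a this
          · simp [hc1 a i h, h]
        · rw [hc0, hroot]
      bag := bag
      edge_mem := by
        rintro ⟨a, i⟩ ⟨b, i'⟩ ⟨hab, hi, hi'⟩
        rw [parentGraph_adj] at hab
        obtain ⟨-, hab | hab⟩ := hab
        · exact ⟨(a, 0), .inr ⟨rfl, .inl rfl, hi⟩, .inr ⟨rfl, .inr hab, hi'⟩⟩
        · exact ⟨(b, 0), .inr ⟨rfl, .inr hab, hi⟩, .inr ⟨rfl, .inl rfl, hi'⟩⟩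
      connected := by
        rintro ⟨a, i⟩
        by_cases hi : (i : ℕ) = 0 ∨ (i : ℕ) = j
        · let c : {x | (a, i) ∈ bag x} := ⟨(a, 0), .inr ⟨rfl, .inl rfl, hi⟩⟩
          refine (connected_iff_exists_forall_reachable _).2 ⟨c, ?_⟩
          have hadj : ∀ x : {x | (a, i) ∈ bag x}, columnParent p x.1 = (a, 0) →
              ((parentGraph (columnParent p)).induce {x | (a, i) ∈ bag x}).Reachable c x := by
            intro x hx
            by_cases hxc : x = c
            · rw [hxc]
            · refine (Adj.reachable ?_).symm
              have hne : columnParent p x.1 ≠ x.1 := fun e => hxc (Subtype.ext (e ▸ hx))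
              have := parentGraph_adj_parent hne
              rw [hx] at this
              exact this
          rintro ⟨⟨b, i'⟩, hb⟩
          have hb' := hb
          rcases hb' with h | ⟨h0, h | h, -⟩
          · obtain ⟨rfl, rfl⟩ := Prod.mk.inj h
            by_cases h0 : i = 0
            · subst h0
              exact Reachable.refl _
            · exact hadj ⟨(a, i), hb⟩ (hc1 a i h0)
          · obtain rfl : i' = 0 := h0
            obtain rfl : a = b := h
            exact Reachable.refl _
          · obtain rfl : i' = 0 := h0
            obtain rfl : a = p b := h
            exact hadj ⟨(b, 0), hb⟩ (hc0 b)
        · have hs : ∀ x : {x | (a, i) ∈ bag x}, x.1 = (a, i) := by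
            rintro ⟨x, h | ⟨-, -, h⟩⟩
            · exact h.symm
            · exact absurd h hi
          have : Subsingleton {x | (a, i) ∈ bag x} :=
            ⟨fun x y => Subtype.ext ((hs x).trans (hs y).symm)⟩
          have : Nonempty {x | (a, i) ∈ bag x} := ⟨⟨(a, i), .inl rfl⟩⟩
          exact .of_subsingleton }
  refine (treewidth_le_width D).trans (D.width_le fun x => ?_)
  have h1 : ({x.1, p x.1} : Set U).ncard ≤ 2 := by
    simpa using Set.ncard_insert_le x.1 {p x.1}
  have h2 : ({0, j} : Set ℕ).ncard ≤ 2 := by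
    simpa using Set.ncard_insert_le 0 {j}
  have h3 := Set.ncard_le_ncard_of_injOn (s := bag x \ {x})
    (t := ({x.1, p x.1} : Set U) ×ˢ ({0, j} : Set ℕ)) (fun y => (y.1, (y.2 : ℕ)))
    (fun y hy => by
      obtain ⟨hy, hy'⟩ := hy
      rcases hy with h | ⟨-, h, h'⟩
      · exact absurd h hy'
      · exact ⟨by simpa using h, by simpa using h'⟩)
    (fun y _ z _ hyz => by
      simp only [Prod.mk.injEq] at hyz
      exact Prod.ext hyz.1 (Fin.ext hyz.2)) (Set.toFinite _)
  rw [Set.ncard_prod] at h3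
  have h4 := Nat.mul_le_mul h1 h2
  have h5 := Set.ncard_le_ncard_sdiff_add_ncard (bag x) {x} (Set.toFinite _)
  rw [Set.ncard_singleton] at h5
  change (bag x).ncard ≤ 4 + 1
  omega

end ParentGraph

/-! ### Grids -/

/-- The `(m + 1) × (m + 1)` grid. -/
def grid (m : ℕ) : SimpleGraph (Fin (m + 1) × Fin (m + 1)) :=
  pathGraph (m + 1) □ pathGraph (m + 1)

theorem grid_connected (m : ℕ) : (grid m).Connected :=
  (pathGraph_connected m).boxProd (pathGraph_connected m)

/-- The crosses, each a row together with the column of the same index, are connected and pairwise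
intersecting, so by the Helly property one bag meets all `m + 1` of them. A vertex lies in at most
two crosses. -/
theorem le_treewidth_grid (m : ℕ) : m + 1 ≤ 2 * (treewidth (grid m) + 1) := by
  classical
  obtain ⟨T, hT, D, hD⟩ := exists_width_eq_treewidth (grid m)
  let cross : Fin (m + 1) → Set (Fin (m + 1) × Fin (m + 1)) := fun i => {v | v.1 = i ∨ v.2 = i}
  have hcross : ∀ i, ((grid m).induce (cross i)).Connected := by
    intro i
    let row : pathGraph (m + 1) →g (grid m).induce (cross i) :=
      { toFun := fun y => ⟨(i, y), .inl rfl⟩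
        map_rel' := fun h => boxProd_adj.2 (.inr ⟨h, rfl⟩) }
    let col : pathGraph (m + 1) →g (grid m).induce (cross i) :=
      { toFun := fun x => ⟨(x, i), .inr rfl⟩
        map_rel' := fun h => boxProd_adj.2 (.inl ⟨h, rfl⟩) }
    refine (connected_iff_exists_forall_reachable _).2 ⟨⟨(i, i), .inl rfl⟩, ?_⟩
    rintro ⟨⟨x, y⟩, h⟩
    have h' := h
    rcases h' with h' | h'
    · obtain rfl : x = i := h'
      exact (pathGraph_preconnected _ x y).map row
    · obtain rfl : y = i := h'
      exact (pathGraph_preconnected _ y x).map col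
  obtain ⟨x, hx⟩ := D.exists_bag_meets cross hcross
    fun i j => ⟨(i, j), .inl rfl, .inr rfl⟩
  have hsub : (Set.univ : Set (Fin (m + 1))) ⊆ Prod.fst '' D.bag x ∪ Prod.snd '' D.bag x := by
    intro i _
    obtain ⟨v, hv, h | h⟩ := hx i
    · exact .inl ⟨v, hv, h⟩
    · exact .inr ⟨v, hv, h⟩
  have h1 := Set.ncard_le_ncard hsub (Set.toFinite _)
  have h2 := Set.ncard_union_le (Prod.fst '' D.bag x) (Prod.snd '' D.bag x)
  have h3 := Set.ncard_image_le (f := Prod.fst) (Set.toFinite (D.bag x))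
  have h4 := Set.ncard_image_le (f := Prod.snd) (Set.toFinite (D.bag x))
  have h5 := D.ncard_bag_le x
  rw [Set.ncard_univ, Nat.card_fin] at h1
  omega

/-- The grid with all diagonals. -/
def kingGraph (m : ℕ) : SimpleGraph (Fin (m + 1) × Fin (m + 1)) where
  Adj a b := a ≠ b ∧ ((a.1 : ℕ) ≤ b.1 + 1 ∧ (b.1 : ℕ) ≤ a.1 + 1) ∧
    ((a.2 : ℕ) ≤ b.2 + 1 ∧ (b.2 : ℕ) ≤ a.2 + 1)
  symm := ⟨fun _ _ h => ⟨h.1.symm, h.2.1.symm, h.2.2.symm⟩⟩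
  loopless := ⟨fun _ h => h.1 rfl⟩

theorem maxDeg_kingGraph_le (m : ℕ) : maxDeg (kingGraph m) ≤ 9 := by
  refine maxDeg_le_iff.2 fun a => ?_
  have h1 := Set.ncard_le_ncard_of_injOn (s := (kingGraph m).neighborSet a)
    (t := ((Finset.Icc ((a.1 : ℤ) - 1) (a.1 + 1) ×ˢ Finset.Icc ((a.2 : ℤ) - 1) (a.2 + 1) :
      Finset (ℤ × ℤ)) : Set (ℤ × ℤ)))
    (fun b => (((b.1 : ℕ) : ℤ), ((b.2 : ℕ) : ℤ)))
    (fun b hb => by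
      obtain ⟨-, h1, h2⟩ := hb
      simp only [Finset.coe_product, Finset.coe_Icc, Set.mem_prod, Set.mem_Icc]
      omega)
    (fun b _ c _ hbc => by
      simp only [Prod.mk.injEq] at hbc
      exact Prod.ext (Fin.ext (by omega)) (Fin.ext (by omega))) (Finset.finite_toSet _)
  rw [Set.ncard_coe_finset, Finset.card_product, Int.card_Icc, Int.card_Icc] at h1
  have h2 : ((a.1 : ℤ) + 1 + 1 - (a.1 - 1)).toNat = 3 := by omega
  have h3 : ((a.2 : ℤ) + 1 + 1 - (a.2 - 1)).toNat = 3 := by omega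
  rwa [h2, h3] at h1

/-- The rank of a grid vertex in the lexicographic order. -/
def gridRank (m : ℕ) (a : Fin (m + 1) × Fin (m + 1)) : ℕ := a.1 * (m + 1) + a.2

/-- The parent of a grid vertex: in the previous column, or, in the first column, the previous
vertex. -/
def gridParent (m : ℕ) (a : Fin (m + 1) × Fin (m + 1)) : Fin (m + 1) × Fin (m + 1) :=
  if (a.1 : ℕ) = 0 then (a.1, ⟨a.2 - 1, by omega⟩) else (⟨a.1 - 1, by omega⟩, a.2)

theorem gridRank_injective (m : ℕ) : Function.Injective (gridRank m) := by
  have hdiv : ∀ a, gridRank m a / (m + 1) = a.1 := fun a => by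
    rw [gridRank, mul_comm, Nat.mul_add_div (by omega), Nat.div_eq_of_lt a.2.isLt, add_zero]
  intro a b hab
  have h1 : (a.1 : ℕ) = b.1 := by rw [← hdiv a, ← hdiv b, hab]
  unfold gridRank at hab
  rw [h1] at hab
  exact Prod.ext (Fin.ext h1) (Fin.ext (by omega))

theorem sub_one_mul_add {k M : ℕ} (hk : k ≠ 0) : (k - 1) * M + M = k * M := by
  obtain ⟨k, rfl⟩ := Nat.exists_eq_succ_of_ne_zero hk
  simp [Nat.succ_mul]

theorem gridRank_gridParent_lt (m : ℕ) (a : Fin (m + 1) × Fin (m + 1)) (ha : gridRank m a ≠ 0) :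
    gridRank m (gridParent m a) < gridRank m a := by
  unfold gridRank gridParent at *
  split_ifs with h
  · rw [h] at ha ⊢
    simp only
    omega
  · have := sub_one_mul_add (M := m + 1) h
    simp only
    omega

/-- A partly merged grid line shifts onto its predecessor, so at the boundary of the shifted portion
an edge is turned into a diagonal; elsewhere both ends move together. -/
theorem kingGraph_adj_retract (m t : ℕ) (ht : 1 ≤ t) (a b : Fin (m + 1) × Fin (m + 1))
    (hab : (grid m).Adj a b)
    (hne : retract (gridRank m) (gridParent m) t a ≠ retract (gridRank m) (gridParent m) t b) :
    (kingGraph m).Adj (retract (gridRank m) (gridParent m) t a)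
      (retract (gridRank m) (gridParent m) t b) := by
  have hp := gridRank_gridParent_lt m
  let C : Fin (m + 1) × Fin (m + 1) → Fin (m + 1) × Fin (m + 1) → Prop := fun a b =>
    ((a.1 : ℕ) ≤ b.1 + 1 ∧ (b.1 : ℕ) ≤ a.1 + 1) ∧ ((a.2 : ℕ) ≤ b.2 + 1 ∧ (b.2 : ℕ) ≤ a.2 + 1)
  let ρ := retract (gridRank m) (gridParent m) t
  have hsymm : ∀ a b, C a b → C b a := fun a b h => ⟨h.1.symm, h.2.symm⟩
  have hparent : ∀ a, gridRank m a ≠ 0 → C (ρ a) (ρ (gridParent m a)) := by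
    intro a ha
    by_cases h : gridRank m a < t
    · simp only [ρ]
      rw [retract_of_lt h, retract_of_lt ((hp a ha).trans h)]
      simp only [C, gridParent]
      split_ifs <;> simp only <;> omega
    · simp only [ρ]
      rw [retract_of_le hp ht (not_lt.1 h)]
      simp only [C]
      omega
  have hvert : ∀ (x : ℕ) (hx : x < m + 1) (y : ℕ) (hy : y + 1 < m + 1),
      C (ρ (⟨x, hx⟩, ⟨y, by omega⟩)) (ρ (⟨x, hx⟩, ⟨y + 1, hy⟩)) := by
    intro x
    induction x with
    | zero =>
      intro hx y hy
      have := hparent (⟨0, hx⟩, ⟨y + 1, hy⟩) (by simp [gridRank])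
      refine hsymm _ _ ?_
      simpa [gridParent] using this
    | succ x ih =>
      intro hx y hy
      have hpar : ∀ y (hy : y < m + 1), gridParent m (⟨x + 1, hx⟩, ⟨y, hy⟩) =
          (⟨x, by omega⟩, ⟨y, hy⟩) := fun y hy => by simp [gridParent]
      have hs : (x + 1) * (m + 1) = x * (m + 1) + (m + 1) := Nat.succ_mul _ _
      simp only [ρ]
      rcases lt_or_ge (gridRank m (⟨x + 1, hx⟩, ⟨y + 1, hy⟩)) t with h | h
      · rw [retract_of_lt h, retract_of_lt]
        · simp only [C]
          omega
        · simp only [gridRank] at h ⊢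
          omega
      · rw [retract_of_le hp ht h, hpar]
        rcases lt_or_ge (gridRank m (⟨x + 1, hx⟩, ⟨y, by omega⟩)) t with h' | h'
        -- The boundary case: one end has moved to `(x, y + 1)` while the other stays at `(x + 1,
        -- y)`, which makes a diagonal.
        · rw [retract_of_lt h', retract_of_lt]
          · simp only [C]
            omega
          · simp only [gridRank] at h' ⊢
            omega
        · rw [retract_of_le hp ht h', hpar]
          exact ih (by omega) y hy
  have hhor : ∀ (x : ℕ) (hx : x + 1 < m + 1) (y : Fin (m + 1)),
      C (ρ (⟨x, by omega⟩, y)) (ρ (⟨x + 1, hx⟩, y)) := by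
    intro x hx y
    have := hparent (⟨x + 1, hx⟩, y) (by simp [gridRank])
    refine hsymm _ _ ?_
    simpa [gridParent] using this
  refine ⟨hne, ?_⟩
  change C (ρ a) (ρ b)
  obtain ⟨⟨x, hx⟩, ⟨y, hy⟩⟩ := a
  obtain ⟨⟨x', hx'⟩, ⟨y', hy'⟩⟩ := b
  rw [grid, boxProd_adj, pathGraph_adj, pathGraph_adj] at hab
  simp only [Fin.mk.injEq] at hab
  rcases hab with ⟨h | h, rfl⟩ | ⟨h | h, rfl⟩
  · subst h
    exact hhor x hx' _
  · subst h
    exact hsymm _ _ (hhor x' hx _)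
  · subst h
    exact hvert x hx y hy'
  · subst h
    exact hsymm _ _ (hvert x hx y' hy)

theorem reduced_maxDeg_grid_le (m n : ℕ) :
    (reduced maxDegParam).val (grid m □ (⊤ : SimpleGraph (Fin (n + 1)))) ≤ 18 := by
  refine reducedVal_boxProd_le maxDegParam_isMonotone (gridRank_injective m)
    (gridRank_gridParent_lt m) (kingGraph_adj_retract m) n 18 fun j => ?_
  have h1 := maxDeg_twoColumns_le (kingGraph m) (n + 1) j
  have h2 := maxDeg_kingGraph_le m
  change maxDeg _ ≤ 18
  omega

/-! ### Ternary trees -/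

/-- The nodes of the complete ternary tree of height `h`. -/
abbrev TernaryNode (h : ℕ) : Type := {l : List (Fin 3) // l.length ≤ h}

instance (h : ℕ) : Finite (TernaryNode h) := List.finite_length_le (Fin 3) h

instance (h : ℕ) : Nonempty (TernaryNode h) := ⟨⟨[], Nat.zero_le _⟩⟩

/-- The parent of a node of the complete ternary tree. -/
def ternaryParent (h : ℕ) (l : TernaryNode h) : TernaryNode h :=
  ⟨l.1.tail, by have := l.2; simp only [List.length_tail]; omega⟩

/-- The complete ternary tree of height `h`. -/
abbrev ternaryTree (h : ℕ) : SimpleGraph (TernaryNode h) := parentGraph (ternaryParent h)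

/-- The position of a word in the breadth-first order. -/
def ternaryRank : List (Fin 3) → ℕ
  | [] => 0
  | a :: l => 3 * ternaryRank l + a + 1

theorem ternaryRank_injective : Function.Injective ternaryRank := by
  intro l
  induction l with
  | nil =>
    intro l' h
    cases l' with
    | nil => rfl
    | cons b l' => simp [ternaryRank] at h
  | cons a l ih =>
    intro l' h
    cases l' with
    | nil => simp [ternaryRank] at h
    | cons b l' =>
      have h1 := a.isLt
      have h2 := b.isLt
      simp only [ternaryRank] at h
      rw [ih (show ternaryRank l = ternaryRank l' by omega), Fin.ext (show (a : ℕ) = b by omega)]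

theorem ternaryRank_ternaryParent_lt (h : ℕ) (l : TernaryNode h) (hl : ternaryRank l.1 ≠ 0) :
    ternaryRank (ternaryParent h l).1 < ternaryRank l.1 := by
  obtain ⟨_ | ⟨a, l⟩, h'⟩ := l
  · exact absurd rfl hl
  · simp only [ternaryParent, List.tail_cons, ternaryRank]
    omega

theorem eq_nil_of_ternaryRank_eq_zero {h : ℕ} (l : TernaryNode h) (hl : ternaryRank l.1 = 0) :
    l = ⟨[], Nat.zero_le _⟩ :=
  Subtype.ext (ternaryRank_injective (by rw [hl]; rfl))

theorem ternaryTree_connected (h : ℕ) : (ternaryTree h).Connected :=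
  (parentGraph_isTree (ternaryParent h) ⟨[], Nat.zero_le _⟩ (fun l => ternaryRank l.1)
    (fun l hl => ternaryRank_ternaryParent_lt h l fun e => hl (eq_nil_of_ternaryRank_eq_zero l e))
    rfl).connected

theorem ternaryTree_adj_cons {h : ℕ} {a : Fin 3} {l : List (Fin 3)} (hl : (a :: l).length ≤ h)
    (hl' : l.length ≤ h) : (ternaryTree h).Adj ⟨a :: l, hl⟩ ⟨l, hl'⟩ := by
  refine parentGraph_adj_parent (p := ternaryParent h) (x := ⟨a :: l, hl⟩) fun e => ?_
  have := congrArg (fun l => l.1.length) e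
  simp [ternaryParent] at this

theorem maxDeg_ternaryTree_le (h : ℕ) : maxDeg (ternaryTree h) ≤ 4 := by
  classical
  refine maxDeg_le_iff.2 fun x => ?_
  have h1 := Set.ncard_le_ncard_of_injOn (s := (ternaryTree h).neighborSet x)
    (t := (({x.1.tail, 0 :: x.1, 1 :: x.1, 2 :: x.1} : Finset (List (Fin 3))) :
      Set (List (Fin 3)))) (fun y => y.1)
    (fun y hy => by
      rw [mem_neighborSet, parentGraph_adj] at hy
      obtain ⟨hne, rfl | rfl⟩ := hy
      · simp [ternaryParent]
      · obtain ⟨_ | ⟨a, l⟩, hl⟩ := y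
        · exact absurd rfl hne
        · simp only [ternaryParent, List.tail_cons]
          fin_cases a <;> simp)
    (fun y _ z _ hyz => Subtype.ext hyz) (Finset.finite_toSet _)
  rw [Set.ncard_coe_finset] at h1
  exact h1.trans Finset.card_le_four

/-- Since the parent removes the first letter, the descendants of `w` are the words with suffix `w`.
Removing letters down to `w` never enters the subtree at `b :: w`. -/
theorem connected_ternaryTree_suffix_diff (h : ℕ) (w : List (Fin 3)) (hw : w.length ≤ h)
    (b : Fin 3) : ((ternaryTree h).induce
      {v : TernaryNode h | w <:+ v.1 ∧ ¬ (b :: w) <:+ v.1}).Connected := by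
  have hself : ¬ (b :: w) <:+ w := fun h => by
    have := h.length_le
    simp at this
  refine (connected_iff_exists_forall_reachable _).2
    ⟨⟨⟨w, hw⟩, List.suffix_rfl, hself⟩, ?_⟩
  have key : ∀ (l : List (Fin 3)) (hl : l.length ≤ h) (hl' : w <:+ l ∧ ¬ (b :: w) <:+ l),
      ((ternaryTree h).induce {v : TernaryNode h | w <:+ v.1 ∧ ¬ (b :: w) <:+ v.1}).Reachable
        ⟨⟨w, hw⟩, List.suffix_rfl, hself⟩ ⟨⟨l, hl⟩, hl'⟩ := by
    intro l
    induction l with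
    | nil =>
      intro hl hl'
      obtain rfl : w = [] := List.suffix_nil.1 hl'.1
      exact Reachable.refl _
    | cons a l ih =>
      intro hl hl'
      rcases List.suffix_cons_iff.1 hl'.1 with h1 | h1
      · subst h1
        exact Reachable.refl _
      · have h2 : l.length ≤ h := (Nat.le_succ _).trans hl
        refine (ih h2 ⟨h1, fun e => hl'.2 (e.trans (List.suffix_cons a l))⟩).trans
          (Adj.reachable ?_)
        exact (ternaryTree_adj_cons hl h2).symm
  rintro ⟨⟨l, hl⟩, hl'⟩
  exact key l hl hl'

/-- By induction on the height `d`, some bag contains `d + 1` vertices of the subtree at `w`. Of the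
bags found for the three children, take the middle one along the path: the rest of the subtree at
`w` is connected and meets the outer two, so it adds a vertex to the middle one. -/
theorem le_pathwidth_ternaryTree (h : ℕ) : h ≤ pathwidth (ternaryTree h) := by
  obtain ⟨T, hT, D, ⟨n, ⟨e⟩⟩, hD⟩ := exists_width_eq_pathwidth (ternaryTree h)
  have key : ∀ d (w : List (Fin 3)), w.length + d ≤ h →
      ∃ x, d + 1 ≤ (D.bag x ∩ {v | w <:+ v.1}).ncard := by
    intro d
    induction d with
    | zero =>
      intro w hw
      obtain ⟨⟨x, hx⟩⟩ := (D.connected ⟨w, hw⟩).nonempty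
      refine ⟨x, ?_⟩
      have : (D.bag x ∩ {v | w <:+ v.1}).Nonempty := ⟨⟨w, hw⟩, hx, List.suffix_rfl⟩
      exact (Set.ncard_pos (Set.toFinite _)).2 this
    | succ d ih =>
      intro w hw
      have hih : ∀ a : Fin 3, ∃ x, d + 1 ≤ (D.bag x ∩ {v | (a :: w) <:+ v.1}).ncard := fun a =>
        ih (a :: w) (by simp only [List.length_cons]; omega)
      choose x hx using hih
      have hsort : ∃ a b c : Fin 3, a ≠ b ∧ c ≠ b ∧ e (x a) ≤ e (x b) ∧ e (x b) ≤ e (x c) := by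
        rcases le_total (e (x 0)) (e (x 1)) with h1 | h1 <;>
        rcases le_total (e (x 1)) (e (x 2)) with h2 | h2 <;>
        rcases le_total (e (x 0)) (e (x 2)) with h3 | h3
        · exact ⟨0, 1, 2, by decide, by decide, h1, h2⟩
        · exact ⟨0, 1, 2, by decide, by decide, h1, h2⟩
        · exact ⟨0, 2, 1, by decide, by decide, h3, h2⟩
        · exact ⟨2, 0, 1, by decide, by decide, h3, h1⟩
        · exact ⟨1, 0, 2, by decide, by decide, h1, h3⟩
        · exact ⟨1, 2, 0, by decide, by decide, h2, h3⟩
        · exact ⟨2, 1, 0, by decide, by decide, h2, h1⟩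
        · exact ⟨2, 1, 0, by decide, by decide, h2, h1⟩
      obtain ⟨a, b, c, hab, hcb, h1, h2⟩ := hsort
      have hmeet : ∀ a, a ≠ b →
          (D.bag (x a) ∩ {v | w <:+ v.1 ∧ ¬ (b :: w) <:+ v.1}).Nonempty := by
        intro a hab
        obtain ⟨v, hv, hva⟩ := (Set.ncard_pos (Set.toFinite _)).1 ((Nat.succ_pos d).trans_le (hx a))
        refine ⟨v, hv, (List.suffix_cons a w).trans hva, fun hvb => hab ?_⟩
        have := (List.suffix_of_suffix_length_le hva hvb (by simp)).eq_of_length (by simp)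
        exact (List.cons.inj this).1
      obtain ⟨v, hv, hvw, hvb⟩ := D.meets_of_between e
        (connected_ternaryTree_suffix_diff h w (by omega) b) (hmeet a hab) (hmeet c hcb) h1 h2
      refine ⟨x b, ?_⟩
      have hlt : (D.bag (x b) ∩ {v | (b :: w) <:+ v.1}).ncard <
          (D.bag (x b) ∩ {v | w <:+ v.1}).ncard :=
        Set.ncard_lt_ncard ⟨fun u hu => ⟨hu.1, (List.suffix_cons b w).trans hu.2⟩,
          fun hsub => hvb (hsub ⟨hv, hvw⟩).2⟩ (Set.toFinite _)
      have := hx b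
      omega
  obtain ⟨x, hx⟩ := key h [] (by simp)
  have h1 := Set.ncard_le_ncard (Set.inter_subset_left : D.bag x ∩ {v | [] <:+ v.1} ⊆ D.bag x)
    (Set.toFinite _)
  have h2 := D.ncard_bag_le x
  omega

/-- The constant is `2 * 4` for the degree of the doubled tree plus `4` for its treewidth. -/
theorem reduced_maxDeg_add_treewidth_ternaryTree_le (h n : ℕ) :
    (reduced (maxDegParam + treewidthParam)).val
      (ternaryTree h □ (⊤ : SimpleGraph (Fin (n + 1)))) ≤ 12 := by
  have hroot : ∀ l : TernaryNode h, ternaryRank l.1 = 0 → ternaryParent h l = l := fun l hl => by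
    rw [eq_nil_of_ternaryRank_eq_zero l hl]
    rfl
  refine reducedVal_boxProd_le (maxDegParam_isMonotone.add treewidthParam_isMonotone)
    (ternaryRank_injective.comp Subtype.val_injective) (ternaryRank_ternaryParent_lt h)
    (fun t ht a b => parentGraph_retract_adj (ternaryRank_ternaryParent_lt h) hroot ht)
    n 12 fun j => ?_
  have h1 := maxDeg_twoColumns_le (ternaryTree h) (n + 1) j
  have h2 := maxDeg_ternaryTree_le h
  have h3 : treewidth (twoColumns (ternaryTree h) (n + 1) j) ≤ 4 :=
    treewidth_twoColumns_parentGraph_le (ternaryRank_ternaryParent_lt h)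
    (root := ⟨[], Nat.zero_le _⟩) eq_nil_of_ternaryRank_eq_zero rfl n j
  change maxDeg (twoColumns (ternaryTree h) (n + 1) j) +
    treewidth (twoColumns (ternaryTree h) (n + 1) j) ≤ 12
  omega

/-! ### Combs -/

/-- The parent of a vertex of the comb: the previous vertex of the same tooth, or, on the spine,
the previous vertex of the spine. -/
def combParent (m : ℕ) (a : Fin (m + 1) × Fin (m + 1)) : Fin (m + 1) × Fin (m + 1) :=
  if (a.2 : ℕ) = 0 then (⟨a.1 - 1, by omega⟩, a.2) else (a.1, ⟨a.2 - 1, by omega⟩)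

/-- The comb with a spine and teeth of `m + 1` vertices. -/
abbrev comb (m : ℕ) : SimpleGraph (Fin (m + 1) × Fin (m + 1)) := parentGraph (combParent m)

theorem gridRank_combParent_lt (m : ℕ) (a : Fin (m + 1) × Fin (m + 1)) (ha : gridRank m a ≠ 0) :
    gridRank m (combParent m a) < gridRank m a := by
  unfold gridRank combParent at *
  split_ifs with h
  · rw [h] at ha ⊢
    have h0 : (a.1 : ℕ) ≠ 0 := fun e => ha (by simp [e])
    have := sub_one_mul_add (M := m + 1) h0
    simp only
    omega
  · simp only
    omega

theorem eq_zero_of_gridRank_eq_zero {m : ℕ} (a : Fin (m + 1) × Fin (m + 1))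
    (ha : gridRank m a = 0) : a = (0, 0) :=
  gridRank_injective m (by rw [ha]; simp [gridRank])

theorem combParent_zero (m : ℕ) : combParent m (0, 0) = (0, 0) := by
  simp [combParent]

theorem comb_connected (m : ℕ) : (comb m).Connected :=
  (parentGraph_isTree (combParent m) (0, 0) (gridRank m)
    (fun a ha => gridRank_combParent_lt m a fun e => ha (eq_zero_of_gridRank_eq_zero a e))
    (combParent_zero m)).connected

theorem maxDeg_comb_le (m : ℕ) : maxDeg (comb m) ≤ 4 := by
  classical
  refine maxDeg_le_iff.2 fun a => ?_
  have h1 := Set.ncard_le_ncard_of_injOn (s := (comb m).neighborSet a)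
    (t := (({((a.1 : ℕ), (a.2 : ℕ) - 1), ((a.1 : ℕ), (a.2 : ℕ) + 1), ((a.1 : ℕ) - 1, 0),
      ((a.1 : ℕ) + 1, 0)} : Finset (ℕ × ℕ)) : Set (ℕ × ℕ)))
    (fun b => ((b.1 : ℕ), (b.2 : ℕ)))
    (fun b hb => by
      have key : ∀ c, c ≠ combParent m c →
          ((c.2 : ℕ) = 0 ∧ ((combParent m c).2 : ℕ) = 0 ∧
            ((combParent m c).1 : ℕ) + 1 = c.1) ∨
          (((combParent m c).2 : ℕ) + 1 = c.2 ∧ ((combParent m c).1 : ℕ) = c.1) := by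
        intro c hc
        by_cases h : (c.2 : ℕ) = 0
        · have h0 : (c.1 : ℕ) ≠ 0 := fun h0 => hc (by
            rw [show c = (0, 0) from Prod.ext (Fin.ext h0) (Fin.ext h), combParent_zero])
          have he : combParent m c = (⟨c.1 - 1, by omega⟩, c.2) := if_pos h
          rw [he]
          exact .inl ⟨h, h, Nat.sub_add_cancel (Nat.pos_of_ne_zero h0)⟩
        · have he : combParent m c = (c.1, ⟨c.2 - 1, by omega⟩) := if_neg h
          rw [he]
          exact .inr ⟨Nat.sub_add_cancel (Nat.pos_of_ne_zero h), rfl⟩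
      rw [mem_neighborSet, parentGraph_adj] at hb
      simp only [Finset.coe_insert, Finset.coe_singleton, Set.mem_insert_iff,
        Set.mem_singleton_iff, Prod.mk.injEq]
      obtain ⟨hne, h | h⟩ := hb
      · have := key a (h ▸ hne)
        rw [← h] at this
        omega
      · have := key b (h ▸ hne.symm)
        rw [← h] at this
        omega)
    (fun b _ c _ hbc => by
      simp only [Prod.mk.injEq] at hbc
      exact Prod.ext (Fin.ext hbc.1) (Fin.ext hbc.2)) (Finset.finite_toSet _)
  rw [Set.ncard_coe_finset] at h1
  exact h1.trans Finset.card_le_four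

/-- A spine vertex gets an interval of length `m + 1`, reaching the next spine vertex and covering
its tooth; a tooth vertex gets the unit interval ending at its rank. A point lies in at most two
intervals of each kind, and doubling gives `8`. -/
theorem pathwidth_twoColumns_comb_le (m n j : ℕ) : pathwidth (twoColumns (comb m) n j) ≤ 8 := by
  classical
  let l : Fin (m + 1) × Fin (m + 1) → ℕ := fun a =>
    if (a.2 : ℕ) = 0 then a.1 * (m + 1) else a.1 * (m + 1) + a.2 - 1
  let r : Fin (m + 1) × Fin (m + 1) → ℕ := fun a =>
    if (a.2 : ℕ) = 0 then a.1 * (m + 1) + (m + 1) else a.1 * (m + 1) + a.2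
  refine pathwidth_twoColumns_le (comb m) l r 4 (fun a => ?_) (fun a b hab => ?_) (fun p => ?_) n j
  · simp only [l, r]
    split_ifs <;> omega
  · have key : ∀ c, l c ≤ r (combParent m c) ∧ l (combParent m c) ≤ r c := by
      intro c
      by_cases h : (c.2 : ℕ) = 0
      · simp only [l, r, combParent, h, if_true]
        by_cases h0 : (c.1 : ℕ) = 0
        · simp [h0]
        · have := sub_one_mul_add (M := m + 1) h0
          omega
      · simp only [l, r, combParent, h, if_false]
        have := c.2.isLt
        split_ifs <;> omega
    rw [parentGraph_adj] at hab
    obtain ⟨-, rfl | rfl⟩ := hab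
    · exact (key a).1
    · exact (key b).2
  · have hsub : {v | l v ≤ p ∧ p ≤ r v} ⊆
        {v | (v.2 : ℕ) = 0 ∧ l v ≤ p ∧ p ≤ r v} ∪ {v | (v.2 : ℕ) ≠ 0 ∧ l v ≤ p ∧ p ≤ r v} := by
      intro v hv
      by_cases h : (v.2 : ℕ) = 0
      · exact .inl ⟨h, hv⟩
      · exact .inr ⟨h, hv⟩
    have h1 := Set.ncard_le_ncard_of_injOn (s := {v | (v.2 : ℕ) = 0 ∧ l v ≤ p ∧ p ≤ r v})
      (t := ((Finset.Icc (p / (m + 1) - 1) (p / (m + 1)) : Finset ℕ) : Set ℕ))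
      (fun v => (v.1 : ℕ))
      (fun v hv => by
        obtain ⟨h, hl, hr⟩ := hv
        simp only [l, r, h, if_true] at hl hr
        simp only [Finset.coe_Icc, Set.mem_Icc]
        refine ⟨?_, (Nat.le_div_iff_mul_le (by omega)).2 hl⟩
        have := Nat.div_le_div_right (c := m + 1) hr
        rw [← Nat.succ_mul, Nat.mul_div_cancel _ (by omega)] at this
        omega)
      (fun v hv w hw hvw => Prod.ext (Fin.ext hvw) (Fin.ext (hv.1.trans hw.1.symm)))
      (Finset.finite_toSet _)
    have h2 := Set.ncard_le_ncard_of_injOn (s := {v | (v.2 : ℕ) ≠ 0 ∧ l v ≤ p ∧ p ≤ r v})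
      (t := (({p, p + 1} : Finset ℕ) : Set ℕ)) (gridRank m)
      (fun v hv => by
        obtain ⟨h, hl, hr⟩ := hv
        simp only [l, r, h, if_false] at hl hr
        simp only [Finset.coe_insert, Finset.coe_singleton, Set.mem_insert_iff,
          Set.mem_singleton_iff, gridRank]
        omega)
      (fun v _ w _ hvw => gridRank_injective m hvw) (Finset.finite_toSet _)
    rw [Set.ncard_coe_finset] at h1 h2
    rw [Nat.card_Icc] at h1
    have h3 := Finset.card_le_two (a := p) (b := p + 1)
    have h4 := Set.ncard_le_ncard hsub (Set.toFinite _)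
    have h5 := Set.ncard_union_le {v | (v.2 : ℕ) = 0 ∧ l v ≤ p ∧ p ≤ r v}
      {v | (v.2 : ℕ) ≠ 0 ∧ l v ≤ p ∧ p ≤ r v}
    omega

/-- All `(m + 1) * (m + 1)` vertices are within `2 * m` parent steps of the corner, so they occupy
distinct positions within distance `2 * m * bandwidth (comb m)` of its position. -/
theorem le_bandwidth_comb (m : ℕ) : (m + 1) * (m + 1) ≤ 4 * m * bandwidth (comb m) + 1 := by
  obtain ⟨σ, hσ⟩ := exists_bandwidth_ordering (comb m)
  set k := bandwidth (comb m)
  have key : ∀ s (a : Fin (m + 1) × Fin (m + 1)), (a.1 : ℕ) + a.2 = s →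
      |((σ a : ℕ) : ℤ) - (σ (0, 0) : ℕ)| ≤ k * s := by
    intro s
    induction s with
    | zero =>
      intro a ha
      have h1 : (a.1 : ℕ) = 0 := by omega
      have h2 : (a.2 : ℕ) = 0 := by omega
      rw [show a = (0, 0) from Prod.ext (Fin.ext h1) (Fin.ext h2)]
      simp
    | succ s ih =>
      intro a ha
      have hs : ((combParent m a).1 : ℕ) + (combParent m a).2 = s := by
        unfold combParent
        split_ifs <;> simp only <;> omega
      have hne : combParent m a ≠ a := fun e => by
        rw [e] at hs
        omega
      have h1 := hσ _ _ (parentGraph_adj_parent hne)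
      have h2 := ih _ hs
      have h3 := abs_sub_le ((σ a : ℕ) : ℤ) (σ (combParent m a) : ℕ) (σ (0, 0) : ℕ)
      push_cast
      linarith
  have hall : ∀ a, |((σ a : ℕ) : ℤ) - (σ (0, 0) : ℕ)| ≤ k * (2 * m) := by
    intro a
    refine (key _ a rfl).trans ?_
    have h1 := a.1.isLt
    have h2 := a.2.isLt
    have h3 : (((a.1 : ℕ) + a.2 : ℕ) : ℤ) ≤ 2 * m := by omega
    exact mul_le_mul_of_nonneg_left h3 (by positivity)
  have h1 := Set.ncard_le_ncard_of_injOn (s := (Set.univ : Set (Fin (m + 1) × Fin (m + 1))))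
    (t := ((Finset.Icc ((σ (0, 0) : ℕ) - k * (2 * m) : ℤ) ((σ (0, 0) : ℕ) + k * (2 * m)) :
      Finset ℤ) : Set ℤ)) (fun a => ((σ a : ℕ) : ℤ))
    (fun a _ => by
      have := abs_le.1 (hall a)
      simp only [Finset.coe_Icc, Set.mem_Icc]
      constructor <;> linarith)
    (fun a _ b _ hab => σ.injective (Fin.ext (by simpa using hab))) (Finset.finite_toSet _)
  rw [Set.ncard_coe_finset, Int.card_Icc, Set.ncard_univ] at h1
  have h2 : ((σ (0, 0) : ℕ) + k * (2 * m) + 1 - ((σ (0, 0) : ℕ) - k * (2 * m)) : ℤ) =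
      ((4 * m * k + 1 : ℕ) : ℤ) := by
    push_cast
    ring
  rw [h2, Int.toNat_natCast] at h1
  have h3 : Nat.card (Fin (m + 1) × Fin (m + 1)) = (m + 1) * (m + 1) := by simp
  exact h3.symm.le.trans h1

theorem reduced_maxDeg_add_pathwidth_comb_le (m n : ℕ) :
    (reduced (maxDegParam + pathwidthParam)).val
      (comb m □ (⊤ : SimpleGraph (Fin (n + 1)))) ≤ 16 := by
  have hroot : ∀ a, gridRank m a = 0 → combParent m a = a := fun a ha => by
    rw [eq_zero_of_gridRank_eq_zero a ha, combParent_zero]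
  refine reducedVal_boxProd_le (maxDegParam_isMonotone.add pathwidthParam_isMonotone)
    (gridRank_injective m) (gridRank_combParent_lt m)
    (fun t ht a b => parentGraph_retract_adj (gridRank_combParent_lt m) hroot ht)
    n 16 fun j => ?_
  have h1 := maxDeg_twoColumns_le (comb m) (n + 1) j
  have h2 := maxDeg_comb_le m
  have h3 := pathwidth_twoColumns_comb_le m (n + 1) j
  change maxDeg (twoColumns (comb m) (n + 1) j) + pathwidth (twoColumns (comb m) (n + 1) j) ≤ 16
  omega

/-! ### Separation -/

theorem not_functionallyBounded_reduced {f g : GraphParameter} (hf : f.IsMonotone)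
    (hd : ∀ {V : Type} [Finite V] [Nonempty V] (G : SimpleGraph V), maxDeg G ≤ 2 * f.val G)
    (C : ℕ)
    (hfam : ∀ B, ∃ (U : Type) (_ : Finite U) (_ : Nontrivial U) (H : SimpleGraph U),
      H.Connected ∧ B < f.val H ∧
      ∀ n, (reduced g).val (H □ (⊤ : SimpleGraph (Fin (n + 1)))) ≤ C) :
    ¬ FunctionallyBounded (reduced f) (reduced g) := by
  rintro ⟨h, hh⟩
  -- The function `h` need not be monotone, so it is replaced by its maximum over `0, …, C`.
  obtain ⟨U, _, _, H, hH, hB, hC⟩ := hfam ((Finset.range (C + 1)).sup h)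
  obtain ⟨n, hn⟩ := exists_val_le_reducedVal_boxProd hf hd hH
  have h1 := hh _ (H □ (⊤ : SimpleGraph (Fin (n + 1))))
  have h2 : h _ ≤ (Finset.range (C + 1)).sup h :=
    Finset.le_sup (f := h) (Finset.mem_range.2 (Nat.lt_succ_of_le (hC n)))
  omega

theorem FunctionallyBounded.trans {f g h : GraphParameter} (hfg : FunctionallyBounded f g)
    (hgh : FunctionallyBounded g h) : FunctionallyBounded f h := by
  obtain ⟨a, ha⟩ := hfg
  obtain ⟨b, hb⟩ := hgh
  refine ⟨fun k => (Finset.range (b k + 1)).sup a, fun V _ _ G => (ha V G).trans ?_⟩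
  exact Finset.le_sup (f := a) (Finset.mem_range.2 (Nat.lt_succ_of_le (hb V G)))

theorem StrictlyBounded.trans {f g h : GraphParameter} (hfg : StrictlyBounded f g)
    (hgh : StrictlyBounded g h) : StrictlyBounded f h :=
  ⟨hfg.1.trans hgh.1, fun hhf => hgh.2 (hhf.trans hfg.1)⟩

theorem strictlyBounded_reduced_maxDeg : StrictlyBounded (reduced maxDegParam)
    (reduced (maxDegParam + treewidthParam)) := by
  refine ⟨functionallyBounded_reduced monotone_id fun G => Nat.le_add_right _ _,
    not_functionallyBounded_reduced (maxDegParam_isMonotone.add treewidthParam_isMonotone)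
      (fun G => ?_) 18 fun B => ?_⟩
  · change maxDeg G ≤ 2 * (maxDeg G + treewidth G)
    omega
  -- The side `2 * B + 4` forces treewidth at least `B + 1`.
  · refine ⟨_, inferInstance, ?_, grid (2 * B + 3), grid_connected _, ?_,
      reduced_maxDeg_grid_le _⟩
    · infer_instance
    · have := le_treewidth_grid (2 * B + 3)
      change B < maxDeg _ + treewidth _
      omega

theorem strictlyBounded_reduced_maxDeg_add_treewidth :
    StrictlyBounded (reduced (maxDegParam + treewidthParam))
      (reduced (maxDegParam + pathwidthParam)) := by
  refine ⟨functionallyBounded_reduced monotone_id fun G =>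
      Nat.add_le_add_left (treewidth_le_pathwidth G) _,
    not_functionallyBounded_reduced (maxDegParam_isMonotone.add pathwidthParam_isMonotone)
      (fun G => ?_) 12 fun B => ?_⟩
  · change maxDeg G ≤ 2 * (maxDeg G + pathwidth G)
    omega
  · refine ⟨_, inferInstance, ?_, ternaryTree (B + 1), ternaryTree_connected _, ?_,
      reduced_maxDeg_add_treewidth_ternaryTree_le _⟩
    · exact ⟨⟨[], by simp⟩, ⟨[0], by simp⟩, by simp⟩
    · have := le_pathwidth_ternaryTree (B + 1)
      change B < maxDeg _ + pathwidth _
      omega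

theorem strictlyBounded_reduced_maxDeg_add_pathwidth :
    StrictlyBounded (reduced (maxDegParam + pathwidthParam)) (reduced bandwidthParam) := by
  refine ⟨functionallyBounded_reduced (h := fun k => 3 * k)
      (fun a b hab => Nat.mul_le_mul le_rfl hab) fun G => ?_,
    not_functionallyBounded_reduced bandwidthParam_isMonotone maxDeg_le_two_mul_bandwidth
      16 fun B => ?_⟩
  · have h1 := maxDeg_le_two_mul_bandwidth G
    have h2 := pathwidth_le_bandwidth G
    change maxDeg G + pathwidth G ≤ 3 * bandwidth G
    omega
  -- Bandwidth at most `B` would give `(4B + 2)² ≤ 4(4B + 1)B + 1`, which is false.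
  · refine ⟨_, inferInstance, ?_, comb (4 * B + 1), comb_connected _, ?_,
      reduced_maxDeg_add_pathwidth_comb_le _⟩
    · infer_instance
    · have h1 := le_bandwidth_comb (4 * B + 1)
      change B < bandwidth _
      by_contra! hle
      have := Nat.mul_le_mul (le_refl (4 * (4 * B + 1))) hle
      nlinarith

end ReducedParam

theorem theorem6p1 :
    (ReducedParam.StrictlyBounded
      (ReducedParam.reduced ReducedParam.maxDegParam)
      (ReducedParam.reduced (ReducedParam.maxDegParam + ReducedParam.treewidthParam)) ∧
    ReducedParam.StrictlyBounded
      (ReducedParam.reduced (ReducedParam.maxDegParam + ReducedParam.treewidthParam))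
      (ReducedParam.reduced (ReducedParam.maxDegParam + ReducedParam.pathwidthParam)) ∧
    ReducedParam.StrictlyBounded
      (ReducedParam.reduced (ReducedParam.maxDegParam + ReducedParam.pathwidthParam))
      (ReducedParam.reduced ReducedParam.bandwidthParam)) ∧
    List.Pairwise ReducedParam.Separated
      [ReducedParam.reduced ReducedParam.maxDegParam,
       ReducedParam.reduced (ReducedParam.maxDegParam + ReducedParam.treewidthParam),
       ReducedParam.reduced (ReducedParam.maxDegParam + ReducedParam.pathwidthParam),
       ReducedParam.reduced ReducedParam.bandwidthParam] := by
  have h1 := ReducedParam.strictlyBounded_reduced_maxDeg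
  have h2 := ReducedParam.strictlyBounded_reduced_maxDeg_add_treewidth
  have h3 := ReducedParam.strictlyBounded_reduced_maxDeg_add_pathwidth
  refine ⟨⟨h1, h2, h3⟩, ?_⟩
  simp only [List.pairwise_cons, List.mem_cons, List.not_mem_nil, or_false, forall_eq_or_imp,
    forall_eq, false_imp_iff, implies_true, List.Pairwise.nil, and_true]
  exact ⟨⟨.inl h1, .inl (h1.trans h2), .inl ((h1.trans h2).trans h3)⟩,
    ⟨.inl h2, .inl (h2.trans h3)⟩, .inl h3⟩
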